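/- Let $N\ge 2$ and equip $\mathbb{R}^N$ with the Euclidean norm. A convex body is a compact convex subset of $\mathbb{R}^N$ with nonempty interior. For $f:\mathbb{R}^N\to\mathbb{R}$ and $x\in\mathbb{R}^N$ let $$\partial f(x)=\mathrm{conv}\Bigl\{\lim_{n\to\infty}\nabla f(x_n)\;:\; x_n\to x,\ f\text{ differentiable at each }x_n\Bigr\}$$ be the Clarke subdifferential (only sequences for which the limit exists are considered). Let $\widehat\partial f(x)$ be the set of all $\nabla\varphi(x)$, where $\varphi:\mathbb{R}^N\to\mathbb{R}$ is $C^1$-smooth, $\varphi\le f$ and $\varphi(x)=f(x)$, and let the limiting subdifferential be $$\partial_L f(x)=\Bigl\{\lim_{n\to\infty} x_n^*\;:\; x_n\to x,\ x_n^*\in\widehat\partial f(x_n)\Bigr\}.$$ (1) There is an everywhere differentiable, $1$-Lipschitz, compactly supported function $f:\mathbb{R}^N\to\mathbb{R}$ such that $\partial f(x)=\partial_L f(x)$ for every $x\in\mathbb{R}^N$, and for every convex body $K\subset\overline{B}(0,1)$ there is $x\in\mathbb{R}^N$ with $\partial f(x)=\partial_L f(x)=K$. (2) There are functions $f_n:\mathbb{R}^N\to\mathbb{R}$,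 $n\ge 1$, with pairwise disjoint supports, such that each $f_n$ is differentiable, $n$-Lipschitz and compactly supported, and for every convex body $K\subset\overline{B}(0,n)$ there is $x\in\mathbb{R}^N$ with $\partial f_n(x)=\partial_L f_n(x)=K$; moreover the sum $g=\sum_{n\ge1}f_n$ is differentiable and locally Lipschitz on $\mathbb{R}^N$, and for every convex body $K\subset\mathbb{R}^N$ there is $x\in\mathbb{R}^N$ with $\partial g(x)=\partial_L g(x)=K$. -/

import Mathlib

open Filter Topology

/-- The Clarke subdifferential of `f` at `x`: the convex hull of all limits of gradients
`∇f(x_n)` along sequences `x_n → x` of points of differentiability of `f`. -/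
noncomputable def clarkeSubdiff {N : ℕ} (f : EuclideanSpace ℝ (Fin N) → ℝ)
    (x : EuclideanSpace ℝ (Fin N)) : Set (EuclideanSpace ℝ (Fin N)) :=
  convexHull ℝ {p | ∃ u : ℕ → EuclideanSpace ℝ (Fin N),
    (∀ n, DifferentiableAt ℝ f (u n)) ∧ Tendsto u atTop (𝓝 x) ∧
      Tendsto (fun n => gradient f (u n)) atTop (𝓝 p)}

/-- The set of Fréchet subgradients of `f` at `x`: the gradients at `x` of the `C¹`-smooth
functions `φ ≤ f` with `φ(x) = f(x)`. -/
def frechetSubdiff {N : ℕ} (f : EuclideanSpace ℝ (Fin N) → ℝ)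
    (x : EuclideanSpace ℝ (Fin N)) : Set (EuclideanSpace ℝ (Fin N)) :=
  {p | ∃ φ : EuclideanSpace ℝ (Fin N) → ℝ,
    ContDiff ℝ 1 φ ∧ (∀ y, φ y ≤ f y) ∧ φ x = f x ∧ gradient φ x = p}

/-- The limiting subdifferential of `f` at `x`: all limits of Fréchet subgradients of `f` at
points converging to `x`. -/
def limitingSubdiff {N : ℕ} (f : EuclideanSpace ℝ (Fin N) → ℝ)
    (x : EuclideanSpace ℝ (Fin N)) : Set (EuclideanSpace ℝ (Fin N)) :=
  {p | ∃ u v : ℕ → EuclideanSpace ℝ (Fin N),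
    (∀ n, v n ∈ frechetSubdiff f (u n)) ∧ Tendsto u atTop (𝓝 x) ∧
      Tendsto v atTop (𝓝 p)}

/-- A convex body: a compact convex set with nonempty interior. -/
def IsConvexBody {N : ℕ} (K : Set (EuclideanSpace ℝ (Fin N))) : Prop :=
  IsCompact K ∧ Convex ℝ K ∧ (interior K).Nonempty

/-!
A function is called tame at `x` if it is differentiable there, its gradients cluster at `x` to a
convex set, and it has a `C¹` minorant touching it at `x`. For a nonnegative function that is tame
everywhere the Clarke and the limiting subdifferential both coincide with the set of cluster points
of the gradient, so it is this set that has to be prescribed.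

Let `Φ` be a compact convex set containing `0`. A tent whose slopes are given by the support
function of `-Φ` becomes, after smoothing, a `C¹` bump whose gradients are nearly dense in `Φ` and
stay close to it. The sets `Φ` contained in a fixed ball `X` form a compact metric space, hence a
continuous image of the Cantor set, which we place in a hyperplane. Over a sequence of its points,
dense with repetitions, put bumps for the corresponding `Φ`, the `k`-th one at height `2⁻ᵏ`, of
diameter much less than `2⁻ᵏ` and of height at most `4⁻ᵏ`. The sum is differentiable with gradient
zero on the hyperplane, because the heights are quadratically small there, and its gradients cluster
at each point of the Cantor set to precisely the set attached to that point.

Adding a smooth bump of slope `p` replaces `0` by an arbitrary `p` in the open unit ball. Stacking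
these functions once more, over a single point and for a dense sequence of slopes `p`, reaches every
convex body, as its interior contains one of the slopes.
-/

section GradientCluster

variable {V : Type*} [NormedAddCommGroup V] [InnerProductSpace ℝ V] [CompleteSpace V]
  {f g : V → ℝ} {x : V}

/-- The set of cluster points of `∇f` at `x`. For a differentiable locally Lipschitz `f` its convex
hull is the Clarke subdifferential of `f` at `x`. -/
def gradientCluster (f : V → ℝ) (x : V) : Set V :=
  {p | MapClusterPt p (𝓝 x) (gradient f)}

/-- The function `f` moved to `z` and zoomed by the factor `r`, keeping its gradients; for `r = 0`
it is `0`. -/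
noncomputable def rescale (r : ℝ) (z : V) (f : V → ℝ) (x : V) : ℝ :=
  r * f (r⁻¹ • (x - z))

theorem mem_gradientCluster_iff_forall_exists_dist_lt {p : V} :
    p ∈ gradientCluster f x ↔ ∀ ε > 0, ∃ u, dist u x < ε ∧ dist (gradient f u) p < ε := by
  refine ⟨fun hp ε hε => ?_, fun h => ?_⟩
  · obtain ⟨u, hu, hux⟩ := ((mapClusterPt_iff_frequently.1 hp _ (Metric.ball_mem_nhds p hε)
      ).and_eventually (Metric.ball_mem_nhds x hε)).exists
    exact ⟨u, hux, hu⟩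
  · refine mapClusterPt_iff_frequently.2 fun s hs => ?_
    obtain ⟨ε, hε, hεs⟩ := Metric.mem_nhds_iff.1 hs
    rw [Metric.nhds_basis_ball.frequently_iff]
    intro δ hδ
    obtain ⟨u, hux, hu⟩ := h (min ε δ) (lt_min hε hδ)
    exact ⟨u, hux.trans_le (min_le_right _ _), hεs (hu.trans_le (min_le_left _ _))⟩

theorem mem_gradientCluster_iff_exists_seq {p : V} :
    p ∈ gradientCluster f x ↔ ∃ u : ℕ → V, Tendsto u atTop (𝓝 x) ∧
      Tendsto (fun n => gradient f (u n)) atTop (𝓝 p) :=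
  ⟨fun hp => hp.exists_seq_tendsto.imp fun _ => And.symm,
    fun ⟨_, hu, hp⟩ => MapClusterPt.of_comp hu hp.mapClusterPt⟩

theorem gradientCluster_congr (h : f =ᶠ[𝓝 x] g) : gradientCluster f x = gradientCluster g x := by
  simp only [gradientCluster, MapClusterPt, Filter.map_congr h.gradient]

theorem gradient_mem_gradientCluster (f : V → ℝ) (x : V) : gradient f x ∈ gradientCluster f x :=
  mem_gradientCluster_iff_exists_seq.2 ⟨fun _ => x, tendsto_const_nhds, tendsto_const_nhds⟩

theorem continuousAt_gradient (hf : ContDiffAt ℝ 1 f x) : ContinuousAt (gradient f) x :=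
  (InnerProductSpace.toDual ℝ V).symm.continuous.continuousAt.comp
    (hf.continuousAt_fderiv one_ne_zero)

theorem gradientCluster_eq_singleton (hf : ContDiffAt ℝ 1 f x) :
    gradientCluster f x = {gradient f x} := by
  refine Set.Subset.antisymm (fun p hp => ?_)
    (Set.singleton_subset_iff.2 (gradient_mem_gradientCluster f x))
  obtain ⟨u, hu, hup⟩ := mem_gradientCluster_iff_exists_seq.1 hp
  exact tendsto_nhds_unique hup ((continuousAt_gradient hf).tendsto.comp hu)

theorem gradient_add (hf : DifferentiableAt ℝ f x) (hg : DifferentiableAt ℝ g x) :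
    gradient (fun y => f y + g y) x = gradient f x + gradient g x := by
  simp only [gradient, fderiv_fun_add hf hg, map_add]

theorem gradient_const_mul (a : ℝ) (f : V → ℝ) (x : V) :
    gradient (fun y => a * f y) x = a • gradient f x := by
  have hsmul : (fun y => a * f y) = a • f := rfl
  rw [gradient, hsmul, fderiv_const_smul_field, Pi.smul_apply, map_smul, gradient]

theorem gradient_rescale {r : ℝ} (hr : r ≠ 0) (z : V) (f : V → ℝ) (x : V) :
    gradient (rescale r z f) x = gradient f (r⁻¹ • (x - z)) := by
  have hcomp : fderiv ℝ (fun y => f (r⁻¹ • (y - z))) x = r⁻¹ • fderiv ℝ f (r⁻¹ • (x - z)) := by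
    rw [fderiv_comp_sub (f := fun y => f (r⁻¹ • y)), fderiv_comp_smul]
  unfold rescale
  rw [gradient_const_mul, gradient, hcomp, map_smul, smul_inv_smul₀ hr, gradient]

theorem gradientCluster_rescale {r : ℝ} (hr : r ≠ 0) (z : V) (f : V → ℝ) (x : V) :
    gradientCluster (rescale r z f) x = gradientCluster f (r⁻¹ • (x - z)) := by
  let φ : V ≃ₜ V := (Homeomorph.subRight z).trans (Homeomorph.smulOfNeZero r⁻¹ (inv_ne_zero hr))
  have hgrad : gradient (rescale r z f) = gradient f ∘ φ := funext (gradient_rescale hr z f)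
  have hφ : 𝓝 (r⁻¹ • (x - z)) = map φ (𝓝 x) := (φ.map_nhds_eq x).symm
  simp only [gradientCluster, MapClusterPt, hgrad, hφ, map_map]

theorem gradientCluster_const_mul {a : ℝ} (ha : a ≠ 0) (f : V → ℝ) (x : V) :
    gradientCluster (fun y => a * f y) x = (a • ·) '' gradientCluster f x := by
  ext p
  simp only [mem_gradientCluster_iff_exists_seq, gradient_const_mul, Set.mem_image]
  constructor
  · rintro ⟨u, hu, hup⟩
    refine ⟨a⁻¹ • p, ⟨u, hu, ?_⟩, smul_inv_smul₀ ha p⟩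
    simpa only [inv_smul_smul₀ ha] using hup.const_smul a⁻¹
  · rintro ⟨q, ⟨u, hu, huq⟩, rfl⟩
    exact ⟨u, hu, huq.const_smul a⟩

theorem gradientCluster_add (hf : ContDiffAt ℝ 1 f x) (hg : ∀ᶠ y in 𝓝 x, DifferentiableAt ℝ g y) :
    gradientCluster (fun y => f y + g y) x = (gradient f x + ·) '' gradientCluster g x := by
  have hadd : ∀ᶠ y in 𝓝 x, gradient (fun y => f y + g y) y = gradient f y + gradient g y := by
    filter_upwards [hg, hf.eventually (by simp)] with y hgy hfy
    exact gradient_add (hfy.differentiableAt one_ne_zero) hgy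
  ext p
  simp only [mem_gradientCluster_iff_exists_seq, Set.mem_image]
  constructor
  · rintro ⟨u, hu, hup⟩
    refine ⟨p - gradient f x, ⟨u, hu, ?_⟩, add_sub_cancel _ _⟩
    refine (hup.sub ((continuousAt_gradient hf).tendsto.comp hu)).congr' ?_
    filter_upwards [hu.eventually hadd] with n hn
    rw [hn, Function.comp_apply, add_sub_cancel_left]
  · rintro ⟨q, ⟨u, hu, huq⟩, rfl⟩
    refine ⟨u, hu, (((continuousAt_gradient hf).tendsto.comp hu).add huq).congr' ?_⟩
    filter_upwards [hu.eventually hadd] with n hn using hn.symm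

theorem gradient_eq_zero_of_notMem_tsupport (hx : x ∉ tsupport f) : gradient f x = 0 := by
  rw [gradient, fderiv_of_notMem_tsupport ℝ hx, map_zero]

theorem gradientCluster_eq_zero_of_notMem_tsupport (hx : x ∉ tsupport f) :
    gradientCluster f x = {0} := by
  have h := notMem_tsupport_iff_eventuallyEq.1 hx
  have hf : ContDiffAt ℝ 1 f x := contDiffAt_const.congr_of_eventuallyEq h
  rw [gradientCluster_eq_singleton hf, gradient_eq_zero_of_notMem_tsupport hx]

theorem lipschitzWith_iff_norm_gradient_le {L : NNReal} (hf : Differentiable ℝ f) :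
    LipschitzWith L f ↔ ∀ x, ‖gradient f x‖ ≤ L := by
  have hnorm (x : V) : ‖gradient f x‖ = ‖fderiv ℝ f x‖ := LinearIsometryEquiv.norm_map _ _
  simp only [hnorm]
  exact ⟨fun h _ => norm_fderiv_le_of_lipschitz ℝ h,
    fun h => lipschitzWith_of_nnnorm_fderiv_le hf h⟩

end GradientCluster

section Tame

variable {V : Type*} [NormedAddCommGroup V] [InnerProductSpace ℝ V] [CompleteSpace V]
  {f g : V → ℝ} {x : V}

/-- Tameness of `f` at `x`: `f` is differentiable at `x`, its gradients cluster at `x` to a convex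
set, and `∇f(x)` is the gradient of a `C¹` function touching `f` from below at `x`. When `f` is
nonnegative and tame at every point, both the Clarke and the limiting subdifferential of `f` are
equal to `gradientCluster f`. -/
structure IsTameAt (f : V → ℝ) (x : V) : Prop where
  differentiableAt : DifferentiableAt ℝ f x
  convex_gradientCluster : Convex ℝ (gradientCluster f x)
  exists_minorant : ∃ ψ : V → ℝ, ContDiffAt ℝ 1 ψ x ∧ ψ ≤ᶠ[𝓝 x] f ∧ ψ x = f x

theorem isTameAt_of_contDiffAt (hf : ContDiffAt ℝ 1 f x) : IsTameAt f x where
  differentiableAt := hf.differentiableAt one_ne_zero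
  convex_gradientCluster := gradientCluster_eq_singleton hf ▸ convex_singleton _
  exists_minorant := ⟨f, hf, EventuallyLE.rfl, rfl⟩

namespace IsTameAt

theorem congr (hf : IsTameAt f x) (h : g =ᶠ[𝓝 x] f) : IsTameAt g x where
  differentiableAt := hf.differentiableAt.congr_of_eventuallyEq h
  convex_gradientCluster := gradientCluster_congr h ▸ hf.convex_gradientCluster
  exists_minorant := by
    obtain ⟨ψ, hψ, hle, heq⟩ := hf.exists_minorant
    exact ⟨ψ, hψ, hle.trans h.symm.le, heq.trans h.eq_of_nhds.symm⟩

theorem const_mul (hf : IsTameAt f x) {a : ℝ} (ha : 0 < a) : IsTameAt (fun y => a * f y) x where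
  differentiableAt := hf.differentiableAt.const_mul a
  convex_gradientCluster := by
    rw [gradientCluster_const_mul ha.ne']
    exact hf.convex_gradientCluster.smul a
  exists_minorant := by
    obtain ⟨ψ, hψ, hle, heq⟩ := hf.exists_minorant
    refine ⟨fun y => a * ψ y, contDiffAt_const.mul hψ, ?_, congrArg (a * ·) heq⟩
    filter_upwards [hle] with y hy using mul_le_mul_of_nonneg_left hy ha.le

theorem rescale {r : ℝ} {z : V} (hr : 0 < r) (hf : IsTameAt f (r⁻¹ • (x - z))) :
    IsTameAt (rescale r z f) x where
  differentiableAt := by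
    have hφ : DifferentiableAt ℝ (fun y => r⁻¹ • (y - z)) x := by fun_prop
    exact (hf.differentiableAt.comp x hφ).const_mul r
  convex_gradientCluster := gradientCluster_rescale hr.ne' z f x ▸ hf.convex_gradientCluster
  exists_minorant := by
    obtain ⟨ψ, hψ, hle, heq⟩ := hf.exists_minorant
    have hφ : ContDiff ℝ 1 fun y : V => r⁻¹ • (y - z) := by fun_prop
    refine ⟨_root_.rescale r z ψ, contDiffAt_const.mul (hψ.comp x hφ.contDiffAt), ?_,
      congrArg (r * ·) heq⟩
    filter_upwards [hφ.continuous.continuousAt.eventually hle] with y hy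
    exact mul_le_mul_of_nonneg_left hy hr.le

theorem contDiffAt_add (hf : ContDiffAt ℝ 1 f x) (hg : IsTameAt g x)
    (hgd : ∀ᶠ y in 𝓝 x, DifferentiableAt ℝ g y) : IsTameAt (fun y => f y + g y) x where
  differentiableAt := (hf.differentiableAt one_ne_zero).add hg.differentiableAt
  convex_gradientCluster := by
    rw [gradientCluster_add hf hgd]
    exact hg.convex_gradientCluster.translate _
  exists_minorant := by
    obtain ⟨ψ, hψ, hle, heq⟩ := hg.exists_minorant
    refine ⟨fun y => f y + ψ y, hf.add hψ, ?_, congrArg (f x + ·) heq⟩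
    filter_upwards [hle] with y hy using add_le_add_right hy (f y)

end IsTameAt

theorem gradient_eq_of_le_of_eq (hg : DifferentiableAt ℝ g x) (hf : DifferentiableAt ℝ f x)
    (hle : g ≤ᶠ[𝓝 x] f) (heq : g x = f x) : gradient g x = gradient f x := by
  have hmin : IsLocalMin (fun y => f y - g y) x := by
    filter_upwards [hle] with y hy
    rw [heq, sub_self]
    exact sub_nonneg.2 hy
  have hzero := hmin.hasFDerivAt_eq_zero (hf.hasFDerivAt.sub hg.hasFDerivAt)
  rw [gradient, gradient, sub_eq_zero.1 hzero]

theorem exists_contDiff_le_of_eventuallyLE {V : Type*} [NormedAddCommGroup V] [NormedSpace ℝ V]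
    [HasContDiffBump V] {f g : V → ℝ} {x : V} (hf : ∀ y, 0 ≤ f y) (hg : ContDiffAt ℝ 1 g x)
    (hle : g ≤ᶠ[𝓝 x] f) :
    ∃ φ : V → ℝ, ContDiff ℝ 1 φ ∧ (∀ y, φ y ≤ f y) ∧ φ x = g x := by
  obtain ⟨ε, hε, hball⟩ := Metric.eventually_nhds_iff.1 ((hg.eventually (by simp)).and hle)
  let χ : ContDiffBump x := ⟨ε / 4, ε / 2, by linarith, by linarith⟩
  have hχ (y : V) (hy : ε / 2 ≤ dist y x) : χ y * g y = 0 := by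
    rw [χ.zero_of_le_dist hy, zero_mul]
  refine ⟨fun y => χ y * g y, contDiff_iff_contDiffAt.2 fun y => ?_, fun y => ?_, ?_⟩
  · rcases lt_or_ge (dist y x) ε with hy | hy
    · exact χ.contDiffAt.mul (hball hy).1
    · refine (contDiffAt_const (c := (0 : ℝ))).congr_of_eventuallyEq ?_
      have hfar : ∀ᶠ w in 𝓝 y, ε / 2 < dist w x :=
        (continuous_id.dist continuous_const).continuousAt.eventually
          (lt_mem_nhds (by simpa only [id_eq] using (half_lt_self hε).trans_le hy))
      filter_upwards [hfar] with w hw using hχ w hw.le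
  · rcases lt_or_ge (dist y x) ε with hy | hy
    · exact (mul_le_mul_of_nonneg_left (hball hy).2 χ.nonneg).trans
        (mul_le_of_le_one_left (hf y) χ.le_one)
    · exact (hχ y (by linarith)).trans_le (hf y)
  · exact (congrArg (· * g x) (χ.one_of_mem_closedBall
      (Metric.mem_closedBall_self χ.rIn_pos.le))).trans (one_mul _)

end Tame

section Subdifferentials

variable {N : ℕ} {f : EuclideanSpace ℝ (Fin N) → ℝ} {x : EuclideanSpace ℝ (Fin N)}

theorem clarkeSubdiff_eq_convexHull (hf : Differentiable ℝ f) (x : EuclideanSpace ℝ (Fin N)) :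
    clarkeSubdiff f x = convexHull ℝ (gradientCluster f x) := by
  refine congrArg (convexHull ℝ) (Set.ext fun p => ?_)
  rw [mem_gradientCluster_iff_exists_seq]
  exact ⟨fun ⟨u, _, hu⟩ => ⟨u, hu⟩, fun ⟨u, hu⟩ => ⟨u, fun n => hf (u n), hu⟩⟩

theorem gradient_mem_frechetSubdiff (hnonneg : ∀ y, 0 ≤ f y) (hf : IsTameAt f x) :
    gradient f x ∈ frechetSubdiff f x := by
  obtain ⟨ψ, hψ, hle, heq⟩ := hf.exists_minorant
  obtain ⟨φ, hφ, hφle, hφeq⟩ := exists_contDiff_le_of_eventuallyLE hnonneg hψ hle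
  exact ⟨φ, hφ, hφle, hφeq.trans heq, gradient_eq_of_le_of_eq
    (hφ.differentiable one_ne_zero x) hf.differentiableAt (.of_forall hφle) (hφeq.trans heq)⟩

theorem eq_gradient_of_mem_frechetSubdiff {p : EuclideanSpace ℝ (Fin N)}
    (hf : DifferentiableAt ℝ f x) (hp : p ∈ frechetSubdiff f x) : p = gradient f x := by
  obtain ⟨φ, hφ, hle, heq, rfl⟩ := hp
  exact gradient_eq_of_le_of_eq (hφ.differentiable one_ne_zero x) hf (.of_forall hle) heq

theorem clarkeSubdiff_eq_gradientCluster (hf : ∀ y, IsTameAt f y) (x : EuclideanSpace ℝ (Fin N)) :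
    clarkeSubdiff f x = gradientCluster f x := by
  rw [clarkeSubdiff_eq_convexHull fun y => (hf y).differentiableAt,
    (hf x).convex_gradientCluster.convexHull_eq]

theorem limitingSubdiff_eq_gradientCluster (hnonneg : ∀ y, 0 ≤ f y) (hf : ∀ y, IsTameAt f y)
    (x : EuclideanSpace ℝ (Fin N)) : limitingSubdiff f x = gradientCluster f x := by
  ext p
  rw [mem_gradientCluster_iff_exists_seq]
  constructor
  · rintro ⟨u, v, hv, hu, hp⟩
    obtain rfl : v = fun n => gradient f (u n) := funext fun n =>
      eq_gradient_of_mem_frechetSubdiff (hf (u n)).differentiableAt (hv n)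
    exact ⟨u, hu, hp⟩
  · rintro ⟨u, hu, hp⟩
    exact ⟨u, _, fun n => gradient_mem_frechetSubdiff hnonneg (hf (u n)), hu, hp⟩

end Subdifferentials

section Mollification

open MeasureTheory ContinuousLinearMap Convolution

variable {V : Type*} [NormedAddCommGroup V] [InnerProductSpace ℝ V] [FiniteDimensional ℝ V]
  [MeasurableSpace V] [BorelSpace V] {φ : ContDiffBump (0 : V)} {b : V → ℝ}

/-- The average of `b` over small translations, weighted by the normalized bump function `φ`. -/
noncomputable def mollify (φ : ContDiffBump (0 : V)) (b : V → ℝ) : V → ℝ :=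
  φ.normed volume ⋆[lsmul ℝ ℝ, volume] b

theorem contDiff_mollify (hb : Continuous b) : ContDiff ℝ 1 (mollify φ b) :=
  φ.hasCompactSupport_normed.contDiff_convolution_left _ φ.contDiff_normed hb.locallyIntegrable

theorem mollify_nonneg (hb : ∀ x, 0 ≤ b x) (x : V) : 0 ≤ mollify φ b x :=
  integral_nonneg fun t => mul_nonneg (φ.nonneg_normed t) (hb (x - t))

theorem hasCompactSupport_mollify (hb : HasCompactSupport b) : HasCompactSupport (mollify φ b) :=
  φ.hasCompactSupport_normed.convolution _ hb

theorem mollify_sub_le (hb : Continuous b) {x y : V} {m : ℝ}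
    (hm : ∀ t ∈ Metric.ball (0 : V) φ.rOut, b (x - t) - b (y - t) ≤ m) :
    mollify φ b x - mollify φ b y ≤ m := by
  have hint (z : V) : Integrable fun t => φ.normed volume t * b (z - t) :=
    (φ.continuous_normed.mul (by fun_prop)).integrable_of_hasCompactSupport
      φ.hasCompactSupport_normed.mul_right
  calc mollify φ b x - mollify φ b y
      = ∫ t, φ.normed volume t * b (x - t) - φ.normed volume t * b (y - t) :=
        (integral_sub (hint x) (hint y)).symm
    _ ≤ ∫ t, φ.normed volume t * m := by
        refine integral_mono ((hint x).sub (hint y)) (φ.integrable_normed.mul_const m) fun t => ?_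
        by_cases ht : t ∈ Metric.ball (0 : V) φ.rOut
        · simpa only [← mul_sub] using mul_le_mul_of_nonneg_left (hm t ht) (φ.nonneg_normed t)
        · rw [← φ.support_normed_eq (μ := volume), Function.notMem_support] at ht
          simp only [ht, zero_mul, sub_self, le_refl]
    _ = m := by rw [integral_mul_const, φ.integral_normed, one_mul]

theorem lipschitzWith_mollify {L : NNReal} (hb : LipschitzWith L b) :
    LipschitzWith L (mollify φ b) := by
  refine LipschitzWith.of_le_add_mul L fun x y => sub_le_iff_le_add'.1 ?_
  refine mollify_sub_le hb.continuous fun t _ => sub_le_iff_le_add'.2 ?_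
  simpa only [dist_sub_right] using hb.le_add_mul (x - t) (y - t)

theorem dist_mollify_le {L : NNReal} (hb : LipschitzWith L b) (x : V) :
    dist (mollify φ b x) (b x) ≤ L * φ.rOut :=
  φ.dist_normed_convolution_le hb.continuous.aestronglyMeasurable fun y hy =>
    (hb.dist_le_mul y x).trans (mul_le_mul_of_nonneg_left (Metric.mem_ball.1 hy).le L.2)

theorem gradient_mollify_eq (hb : Continuous b) {p : V} {a r : ℝ}
    (haff : ∀ x ∈ Metric.ball (0 : V) (r + φ.rOut), b x = a + inner ℝ p x) {x : V}
    (hx : x ∈ Metric.ball (0 : V) r) : gradient (mollify φ b) x = p := by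
  have hsub (y z : V) (hy : y ∈ Metric.ball (0 : V) r) (hz : z ∈ Metric.ball (0 : V) r) :
      mollify φ b y - mollify φ b z ≤ inner ℝ p (y - z) := by
    refine mollify_sub_le hb fun t ht => ?_
    rw [mem_ball_zero_iff] at hy hz ht
    rw [haff, haff, add_sub_add_left_eq_sub, ← inner_sub_right, sub_sub_sub_cancel_right] <;>
      exact mem_ball_zero_iff.2 ((norm_sub_le _ _).trans_lt (by linarith))
  have heq : mollify φ b =ᶠ[𝓝 x] fun y => inner ℝ p y + (mollify φ b x - inner ℝ p x) := by
    filter_upwards [Metric.isOpen_ball.mem_nhds hx] with y hy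
    have hle := hsub y x hy hx
    have hge := hsub x y hx hy
    rw [inner_sub_right] at hle hge
    linarith
  have hlin : HasFDerivAt (fun y => inner ℝ p y + (mollify φ b x - inner ℝ p x))
      (InnerProductSpace.toDual ℝ V p) x :=
    (InnerProductSpace.toDual ℝ V p).hasFDerivAt.add_const _
  exact ((hasGradientAt_iff_hasFDerivAt.2 hlin).congr_of_eventuallyEq heq).gradient

end Mollification

section Bumps

variable {V : Type*} [NormedAddCommGroup V] [InnerProductSpace ℝ V]

theorem inner_gradient_le_of_sub_le [CompleteSpace V] {f σ : V → ℝ} {x : V}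
    (hf : DifferentiableAt ℝ f x) (hσ : ∀ s > 0, ∀ v, σ (s • v) = s * σ v)
    (h : ∀ y z, f y - f z ≤ σ (y - z)) (v : V) : inner ℝ (gradient f x) v ≤ σ v := by
  have hlim : Tendsto (fun s : ℝ => s⁻¹ • (f (x + s • v) - f x)) (𝓝[>] 0)
      (𝓝 (fderiv ℝ f x v)) :=
    hf.hasFDerivAt.hasLineDerivAt v |>.tendsto_slope_zero_right
  rw [inner_gradient_left]
  refine le_of_tendsto hlim ?_
  filter_upwards [self_mem_nhdsWithin] with s (hs : 0 < s)
  rw [smul_eq_mul, inv_mul_le_iff₀ hs, ← hσ s hs]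
  simpa only [add_sub_cancel_left] using h (x + s • v) x

variable [FiniteDimensional ℝ V]

theorem exists_lipschitzWith_gradient_eq {p : V} (hp : ‖p‖ ≤ 1) {r : ℝ} (hr : 0 ≤ r) :
    ∃ A : V → ℝ, ContDiff ℝ 1 A ∧ (∀ x, 0 ≤ A x) ∧ HasCompactSupport A ∧ LipschitzWith 1 A ∧
      ∀ x ∈ Metric.ball 0 r, gradient A x = p := by
  borelize V
  let φ : ContDiffBump (0 : V) := ⟨1 / 2, 1, by norm_num, by norm_num⟩
  let b : V → ℝ := fun x => max 0 (min (r + 1 + inner ℝ p x) (3 * (r + 1) - ‖x‖))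
  have hinner (x : V) : |inner ℝ p x| ≤ ‖x‖ :=
    (abs_real_inner_le_norm p x).trans (mul_le_of_le_one_left (norm_nonneg x) hp)
  have hb : LipschitzWith 1 b := by
    have hlin : LipschitzWith 1 fun x : V => inner ℝ p x := by
      have hnorm : ‖InnerProductSpace.toDual ℝ V p‖₊ ≤ 1 := by
        rwa [LinearIsometryEquiv.nnnorm_map, ← NNReal.coe_le_coe]
      exact (InnerProductSpace.toDual ℝ V p).lipschitz.weaken hnorm
    simpa only [add_zero, zero_add, max_self] using ((LipschitzWith.const (r + 1)).add hlin).min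
      ((LipschitzWith.const (3 * (r + 1))).sub lipschitzWith_one_norm) |>.const_max 0
  have hsupp : HasCompactSupport b := by
    refine .intro (isCompact_closedBall 0 (3 * (r + 1))) fun x hx => max_eq_left ?_
    rw [mem_closedBall_zero_iff, not_le] at hx
    exact (min_le_right _ _).trans (by linarith)
  have haff (x : V) (hx : x ∈ Metric.ball 0 (r + φ.rOut)) : b x = r + 1 + inner ℝ p x := by
    have hxr : ‖x‖ < r + 1 := mem_ball_zero_iff.1 hx
    obtain ⟨hlow, hup⟩ := abs_le.1 (hinner x)
    exact (max_eq_right (le_min (by linarith) (by linarith))).trans (min_eq_left (by linarith))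
  exact ⟨mollify φ b, contDiff_mollify hb.continuous, mollify_nonneg fun x => le_max_left _ _,
    hasCompactSupport_mollify hsupp, lipschitzWith_mollify hb,
    fun x hx => gradient_mollify_eq hb.continuous haff hx⟩

end Bumps

section SupportFunction

variable {V : Type*} [NormedAddCommGroup V] [InnerProductSpace ℝ V] {σ τ : V → ℝ} {C K : Set V}

/-- Sublinearity: subadditive and positively homogeneous. -/
structure IsSublinear (σ : V → ℝ) : Prop where
  add_le : ∀ v w, σ (v + w) ≤ σ v + σ w
  smul_eq : ∀ s > 0, ∀ v, σ (s • v) = s * σ v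

/-- The support function of `C`, with the junk value `0` where it would be infinite. -/
noncomputable def supportFun (C : Set V) (v : V) : ℝ := ⨆ q : C, inner ℝ (q : V) v

namespace IsSublinear

theorem add (hσ : IsSublinear σ) (hτ : IsSublinear τ) : IsSublinear fun v => σ v + τ v where
  add_le v w := by linarith [hσ.add_le v w, hτ.add_le v w]
  smul_eq s hs v := by rw [hσ.smul_eq s hs, hτ.smul_eq s hs, mul_add]

theorem const_mul (hσ : IsSublinear σ) {a : ℝ} (ha : 0 ≤ a) : IsSublinear fun v => a * σ v where
  add_le v w := by simpa only [mul_add] using mul_le_mul_of_nonneg_left (hσ.add_le v w) ha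
  smul_eq s hs v := by rw [hσ.smul_eq s hs, mul_left_comm]

theorem map_zero (hσ : IsSublinear σ) : σ 0 = 0 := by
  have h := hσ.smul_eq 2 two_pos 0
  rw [smul_zero] at h
  linarith

theorem lipschitzWith (hσ : IsSublinear σ) {B : NNReal} (hB : ∀ v, σ v ≤ B * ‖v‖) :
    LipschitzWith B σ := by
  refine LipschitzWith.of_le_add_mul B fun v w => ?_
  have hadd := hσ.add_le w (v - w)
  rw [add_sub_cancel] at hadd
  rw [dist_eq_norm]
  exact hadd.trans (add_le_add_right (hB _) _)

end IsSublinear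

theorem inner_le_supportFun (hC : Bornology.IsBounded C) {q : V} (hq : q ∈ C) (v : V) :
    inner ℝ q v ≤ supportFun C v := by
  obtain ⟨B, hB⟩ := hC.exists_norm_le
  refine le_ciSup (f := fun q : C => inner ℝ (q : V) v) ⟨B * ‖v‖, ?_⟩ ⟨q, hq⟩
  rintro _ ⟨q, rfl⟩
  exact (real_inner_le_norm _ _).trans (by gcongr; exact hB q q.2)

theorem supportFun_le (hC : C.Nonempty) {v : V} {m : ℝ} (h : ∀ q ∈ C, inner ℝ q v ≤ m) :
    supportFun C v ≤ m :=
  have := hC.to_subtype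
  ciSup_le fun q => h q q.2

theorem supportFun_mono (hK : K.Nonempty) (hC : Bornology.IsBounded C) (hKC : K ⊆ C) (v : V) :
    supportFun K v ≤ supportFun C v :=
  supportFun_le hK fun _ hq => inner_le_supportFun hC (hKC hq) v

theorem isSublinear_supportFun (hne : C.Nonempty) (hC : Bornology.IsBounded C) :
    IsSublinear (supportFun C) where
  add_le v w := supportFun_le hne fun q hq => by
    rw [inner_add_right]
    exact add_le_add (inner_le_supportFun hC hq v) (inner_le_supportFun hC hq w)
  smul_eq s hs v := by
    simp only [supportFun, real_inner_smul_right, Real.mul_iSup_of_nonneg hs.le]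

theorem supportFun_le_mul_norm (hne : C.Nonempty) {B : ℝ} (hB : C ⊆ Metric.closedBall 0 B) (v : V) :
    supportFun C v ≤ B * ‖v‖ :=
  supportFun_le hne fun q hq => (real_inner_le_norm q v).trans
    (mul_le_mul_of_nonneg_right (mem_closedBall_zero_iff.1 (hB hq)) (norm_nonneg v))

theorem mul_norm_le_supportFun (hC : Bornology.IsBounded C) {r : ℝ} (hr : 0 ≤ r)
    (hrC : Metric.closedBall 0 r ⊆ C) (v : V) : r * ‖v‖ ≤ supportFun C v := by
  have hmem : (r * ‖v‖⁻¹) • v ∈ C := by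
    refine hrC (mem_closedBall_zero_iff.2 ?_)
    rw [norm_smul, Real.norm_of_nonneg (by positivity), mul_assoc]
    exact mul_le_of_le_one_right hr (inv_mul_le_one)
  refine (inner_le_supportFun hC hmem v).trans' (le_of_eq ?_)
  rcases eq_or_ne ‖v‖ 0 with hv | hv
  · simp [hv]
  · rw [real_inner_smul_left, real_inner_self_eq_norm_sq]
    field_simp

theorem exists_dist_le_of_inner_le_supportFun (hne : K.Nonempty) (hK : IsComplete K)
    (hconv : Convex ℝ K) {p : V} {δ : ℝ} (hδ : 0 ≤ δ)
    (h : ∀ v, inner ℝ p v ≤ supportFun K v + δ * ‖v‖) : ∃ q ∈ K, dist p q ≤ δ := by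
  obtain ⟨q, hq, hmin⟩ := exists_norm_eq_iInf_of_complete_convex hne hK hconv p
  have hobtuse := (norm_eq_iInf_iff_real_inner_le_zero hconv hq).1 hmin
  have hsupp : supportFun K (p - q) ≤ inner ℝ q (p - q) := supportFun_le hne fun w hw => by
    rw [← sub_nonpos, ← inner_sub_left, real_inner_comm]
    exact hobtuse w hw
  have hle : ‖p - q‖ * ‖p - q‖ ≤ δ * ‖p - q‖ := by
    rw [← real_inner_self_eq_norm_mul_norm, inner_sub_left]
    linarith [h (p - q)]
  refine ⟨q, hq, (dist_eq_norm p q).trans_le ?_⟩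
  rcases (norm_nonneg (p - q)).eq_or_lt with hzero | hpos
  · exact hzero.ge.trans hδ
  · exact le_of_mul_le_mul_right hle hpos

theorem mem_of_inner_le_supportFun (hne : K.Nonempty) (hK : IsComplete K) (hconv : Convex ℝ K)
    {p : V} (h : ∀ v, inner ℝ p v ≤ supportFun K v) : p ∈ K := by
  obtain ⟨q, hq, hdist⟩ := exists_dist_le_of_inner_le_supportFun hne hK hconv le_rfl (p := p)
    fun v => by simpa only [zero_mul, add_zero] using h v
  exact dist_le_zero.1 hdist ▸ hq

theorem exists_isSublinear_between {X Φ : Set V} (hX : IsCompact X) (hXconv : Convex ℝ X)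
    (hX₀ : X ∈ 𝓝 0) (hΦ : IsCompact Φ) (hΦconv : Convex ℝ Φ) (hΦ₀ : 0 ∈ Φ) (hΦX : Φ ⊆ X) {δ : ℝ}
    (hδ : 0 < δ) :
    ∃ (σ : V → ℝ) (r θ : ℝ) (B : NNReal), IsSublinear σ ∧ 0 < r ∧ θ < 1 ∧
      (∀ v, r * ‖v‖ ≤ σ v) ∧ (∀ v, σ v ≤ B * ‖v‖) ∧
      (∀ p, (∀ v, inner ℝ p v ≤ σ v) → p ∈ X ∧ ∃ q ∈ Φ, dist p q ≤ δ) ∧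
      ∀ q ∈ Φ, ∃ p, dist p q ≤ δ ∧ ∀ v, inner ℝ p v ≤ θ * σ v := by
  obtain ⟨r, hr, hrX⟩ := Metric.nhds_basis_closedBall.mem_iff.1 hX₀
  obtain ⟨B, hB₀, hB⟩ := hX.isBounded.subset_closedBall_lt 0 0
  lift B to NNReal using hB₀.le
  have hXne : X.Nonempty := ⟨0, hΦX hΦ₀⟩
  have hΦne : Φ.Nonempty := ⟨0, hΦ₀⟩
  have hle := supportFun_mono hΦne hX.isBounded hΦX
  have hnonneg (v : V) : 0 ≤ supportFun Φ v := by
    simpa only [inner_zero_left] using inner_le_supportFun hΦ.isBounded hΦ₀ v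
  have hXB := supportFun_le_mul_norm hXne hB
  let ε : ℝ := δ / (δ + B)
  have hε : 0 < ε := by positivity
  have hε₁ : 0 ≤ 1 - ε := sub_nonneg.2 (div_le_one_of_le₀ (by simp) (by positivity))
  have hεB : ε * B ≤ δ := by
    rw [div_mul_eq_mul_div, div_le_iff₀ (by positivity)]
    nlinarith
  let σ (v : V) : ℝ := (1 - ε) * supportFun Φ v + ε * supportFun X v
  have hΦσ (v : V) : supportFun Φ v ≤ σ v := by nlinarith [hle v]
  have hσX (v : V) : σ v ≤ supportFun X v := by nlinarith [hle v]
  have hσΦ (v : V) : σ v ≤ supportFun Φ v + δ * ‖v‖ := by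
    nlinarith [hnonneg v, hXB v, norm_nonneg v]
  refine ⟨σ, ε * r, 1 - ε, B, ((isSublinear_supportFun hΦne hΦ.isBounded).const_mul hε₁).add
    ((isSublinear_supportFun hXne hX.isBounded).const_mul hε.le), mul_pos hε hr,
    sub_lt_self 1 hε, fun v => ?_, fun v => (hσX v).trans (hXB v), fun p hp => ⟨?_, ?_⟩,
    fun q hq => ⟨(1 - ε) • q, ?_, fun v => ?_⟩⟩
  · nlinarith [mul_norm_le_supportFun hX.isBounded hr.le hrX v, hnonneg v]
  · exact mem_of_inner_le_supportFun hXne hX.isComplete hXconv fun v => (hp v).trans (hσX v)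
  · exact exists_dist_le_of_inner_le_supportFun hΦne hΦ.isComplete hΦconv hδ.le fun v =>
      (hp v).trans (hσΦ v)
  · rw [dist_comm, dist_eq_norm, sub_smul, one_smul, sub_sub_cancel, norm_smul,
      Real.norm_of_nonneg hε.le]
    exact (mul_le_mul_of_nonneg_left (mem_closedBall_zero_iff.1 (hB (hΦX hq))) hε.le).trans hεB
  · rw [real_inner_smul_left]
    exact mul_le_mul_of_nonneg_left ((inner_le_supportFun hΦ.isBounded hq v).trans (hΦσ v)) hε₁

end SupportFunction

section Tents

variable {V : Type*} [NormedAddCommGroup V] [InnerProductSpace ℝ V] {σ : V → ℝ} {B : NNReal}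

/-- The tent of height `1` over the origin whose slopes are prescribed by `σ`. -/
noncomputable def tent (σ : V → ℝ) (x : V) : ℝ := max 0 (1 - σ (-x))

theorem tent_sub_le (hσ : IsSublinear σ) (hnonneg : ∀ v, 0 ≤ σ v) (x y : V) :
    tent σ x - tent σ y ≤ σ (x - y) := by
  have hadd : σ (-y) ≤ σ (-x) + σ (x - y) := by
    simpa only [← sub_eq_neg_add, sub_sub_cancel_left] using hσ.add_le (-x) (x - y)
  rw [sub_le_iff_le_add']
  exact max_le (add_nonneg (le_max_left _ _) (hnonneg _))
    ((by linarith : 1 - σ (-x) ≤ 1 - σ (-y) + σ (x - y)).trans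
      (add_le_add_left (le_max_right _ _) _))

theorem lipschitzWith_tent (hσ : IsSublinear σ) (hB : ∀ v, σ v ≤ B * ‖v‖) :
    LipschitzWith B (tent σ) := by
  have hneg : LipschitzWith B fun x => σ (-x) := fun x y => by
    simpa only [edist_neg_neg] using hσ.lipschitzWith hB (-x) (-y)
  have hsub : LipschitzWith B fun x => 1 - σ (-x) := by
    simpa only [zero_add] using (LipschitzWith.const 1).sub hneg
  exact hsub.const_max 0

variable [FiniteDimensional ℝ V] {r : ℝ}

theorem isCompact_setOf_neg_le_one (hσ : Continuous σ) (hr : 0 < r)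
    (hlow : ∀ v, r * ‖v‖ ≤ σ v) : IsCompact {x | σ (-x) ≤ 1} := by
  refine (isCompact_closedBall 0 r⁻¹).of_isClosed_subset
    (isClosed_le (by fun_prop) continuous_const) fun x (hx : σ (-x) ≤ 1) => ?_
  rw [mem_closedBall_zero_iff, ← norm_neg, ← mul_one r⁻¹, le_inv_mul_iff₀ hr]
  exact (hlow (-x)).trans hx

theorem hasCompactSupport_tent (hσ : Continuous σ) (hr : 0 < r) (hlow : ∀ v, r * ‖v‖ ≤ σ v) :
    HasCompactSupport (tent σ) :=
  .intro (isCompact_setOf_neg_le_one hσ hr hlow) fun _ hx =>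
    max_eq_left (sub_nonpos.2 (not_le.1 hx).le)

theorem exists_gradient_mollify_tent_eq [MeasurableSpace V] [BorelSpace V]
    {φ : ContDiffBump (0 : V)} (hσ : IsSublinear σ) (hr : 0 < r) (hlow : ∀ v, r * ‖v‖ ≤ σ v)
    (hB : ∀ v, σ v ≤ B * ‖v‖) {θ : ℝ} (hθ : 2 * (B * φ.rOut) < 1 - θ) {q : V}
    (hq : ∀ v, inner ℝ q v ≤ θ * σ v) : ∃ x, gradient (mollify φ (tent σ)) x = q := by
  set β := mollify φ (tent σ)
  have hcont : Continuous σ := (hσ.lipschitzWith hB).continuous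
  have hβ : ContDiff ℝ 1 β := contDiff_mollify (lipschitzWith_tent hσ hB).continuous
  have hclose (x : V) := abs_le.1 (dist_mollify_le (φ := φ) (lipschitzWith_tent hσ hB) x)
  have hzero : tent σ 0 = 1 := by simp [tent, hσ.map_zero]
  have hboundary (x : V) (hx : σ (-x) = 1) : β x - inner ℝ q x < β 0 - inner ℝ q 0 := by
    have htent : tent σ x = 0 := by simp [tent, hx]
    have hqx := hq (-x)
    rw [inner_neg_right, hx] at hqx
    rw [inner_zero_right]
    linarith [(hclose x).2, (hclose 0).1]
  obtain ⟨x, -, hmax⟩ := (isCompact_setOf_neg_le_one hcont hr hlow).exists_isLocalMax_mem_open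
    (f := fun x => β x - inner ℝ q x) (s := {x | σ (-x) < 1}) (z := 0)
    (fun x (hx : σ (-x) < 1) => hx.le) (hβ.continuous.sub (by fun_prop)).continuousOn
    (by simp [hσ.map_zero]) (fun x hx => hboundary x (le_antisymm hx.1 (not_lt.1 hx.2)))
    (isOpen_lt (by fun_prop) continuous_const)
  refine ⟨x, ?_⟩
  have hderiv := hmax.hasFDerivAt_eq_zero ((hβ.differentiable one_ne_zero x).hasFDerivAt.sub
    (InnerProductSpace.toDual ℝ V q).hasFDerivAt)
  rw [gradient, sub_eq_zero.1 hderiv, LinearIsometryEquiv.symm_apply_apply]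

theorem exists_contDiff_gradient_eq_of_isSublinear (hσ : IsSublinear σ) (hr : 0 < r)
    (hlow : ∀ v, r * ‖v‖ ≤ σ v) (hB : ∀ v, σ v ≤ B * ‖v‖) {θ : ℝ} (hθ : θ < 1) :
    ∃ β : V → ℝ, ContDiff ℝ 1 β ∧ (∀ x, 0 ≤ β x) ∧ HasCompactSupport β ∧
      (∀ x v, inner ℝ (gradient β x) v ≤ σ v) ∧
      ∀ q : V, (∀ v, inner ℝ q v ≤ θ * σ v) → ∃ x, gradient β x = q := by
  borelize V
  let η : ℝ := (1 - θ) / (4 * (B + 1))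
  have hη : 0 < η := div_pos (sub_pos.2 hθ) (by positivity)
  have hBη : 2 * (B * η) < 1 - θ := by
    have hdef : η * (4 * (B + 1)) = 1 - θ := div_mul_cancel₀ _ (by positivity)
    nlinarith [B.coe_nonneg]
  let φ : ContDiffBump (0 : V) := ⟨η / 2, η, by linarith, by linarith⟩
  have hnonneg (v : V) : 0 ≤ σ v := (by positivity : 0 ≤ r * ‖v‖).trans (hlow v)
  have htent := (lipschitzWith_tent hσ hB).continuous
  have hβ : ContDiff ℝ 1 (mollify φ (tent σ)) := contDiff_mollify htent
  refine ⟨mollify φ (tent σ), hβ, mollify_nonneg fun x => le_max_left _ _,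
    hasCompactSupport_mollify (hasCompactSupport_tent (hσ.lipschitzWith hB).continuous hr hlow),
    fun x v => ?_, fun q hq => exists_gradient_mollify_tent_eq hσ hr hlow hB hBη hq⟩
  refine inner_gradient_le_of_sub_le (hβ.differentiable one_ne_zero x) hσ.smul_eq
    (fun y z => mollify_sub_le htent fun t _ => ?_) v
  simpa only [sub_sub_sub_cancel_right] using tent_sub_le hσ hnonneg (y - t) (z - t)

theorem exists_contDiff_gradient_dense {X Φ : Set V} (hX : IsCompact X) (hXconv : Convex ℝ X)
    (hX₀ : X ∈ 𝓝 0) (hΦ : IsCompact Φ) (hΦconv : Convex ℝ Φ) (hΦ₀ : 0 ∈ Φ) (hΦX : Φ ⊆ X) {δ : ℝ}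
    (hδ : 0 < δ) :
    ∃ β : V → ℝ, ContDiff ℝ 1 β ∧ (∀ x, 0 ≤ β x) ∧ HasCompactSupport β ∧
      (∀ x, gradient β x ∈ X ∧ ∃ q ∈ Φ, dist (gradient β x) q ≤ δ) ∧
      ∀ q ∈ Φ, ∃ x, dist (gradient β x) q ≤ δ := by
  obtain ⟨σ, r, θ, B, hσ, hr, hθ, hlow, hB, hnear, hdense⟩ :=
    exists_isSublinear_between hX hXconv hX₀ hΦ hΦconv hΦ₀ hΦX hδ
  obtain ⟨β, hβ, hnonneg, hsupp, hle, heq⟩ :=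
    exists_contDiff_gradient_eq_of_isSublinear hσ hr hlow hB hθ
  refine ⟨β, hβ, hnonneg, hsupp, fun x => hnear _ (hle x), fun q hq => ?_⟩
  obtain ⟨p, hpq, hp⟩ := hdense q hq
  obtain ⟨x, rfl⟩ := heq p hp
  exact ⟨x, hpq⟩

end Tents

section CantorFamily

open TopologicalSpace

theorem exists_seq_forall_mapClusterPt (X : Type*) [TopologicalSpace X] [SeparableSpace X]
    [Nonempty X] : ∃ d : ℕ → X, ∀ a, MapClusterPt a atTop d := by
  refine ⟨fun k => denseSeq X k.unpair.1, fun a => mapClusterPt_iff_frequently.2 fun s hs => ?_⟩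
  obtain ⟨i, hi⟩ := (denseRange_denseSeq X).exists_mem_open isOpen_interior
    ⟨a, mem_interior_iff_mem_nhds.2 hs⟩
  refine frequently_atTop.2 fun n => ⟨Nat.pair i n, Nat.right_le_pair i n, ?_⟩
  simpa only [Nat.unpair_pair] using interior_subset hi

theorem exists_dist_lt_of_nonemptyCompacts_dist_lt {X : Type*} [MetricSpace X]
    {K L : NonemptyCompacts X} {ε : ℝ} (h : dist K L < ε) {x : X} (hx : x ∈ K) :
    ∃ y ∈ L, dist x y < ε :=
  Metric.exists_dist_lt_of_hausdorffDist_lt hx h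
    (Metric.hausdorffEDist_ne_top_of_nonempty_of_bounded K.nonempty L.nonempty
      K.isCompact.isBounded L.isCompact.isBounded)

variable {V : Type*} [NormedAddCommGroup V]

theorem isClosed_setOf_convex_nonemptyCompacts [NormedSpace ℝ V] :
    IsClosed {K : NonemptyCompacts V | Convex ℝ (K : Set V)} := by
  refine isClosed_of_closure_subset fun K hK x hx y hy a b ha hb hab => ?_
  refine K.isCompact.isClosed.closure_subset (Metric.mem_closure_iff.2 fun ε hε => ?_)
  obtain ⟨L, hL, hKL⟩ := Metric.mem_closure_iff.1 hK (ε / 2) (half_pos hε)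
  obtain ⟨x', hx', hxx'⟩ := exists_dist_lt_of_nonemptyCompacts_dist_lt hKL hx
  obtain ⟨y', hy', hyy'⟩ := exists_dist_lt_of_nonemptyCompacts_dist_lt hKL hy
  obtain ⟨z, hz, hzz'⟩ := exists_dist_lt_of_nonemptyCompacts_dist_lt (dist_comm K L ▸ hKL)
    (hL hx' hy' ha hb hab)
  have hconv : dist (a • x + b • y) (a • x' + b • y') < ε / 2 := by
    have hle : dist (a • x + b • y) (a • x' + b • y') ≤ a * dist x x' + b * dist y y' := by
      simpa only [dist_smul₀, Real.norm_of_nonneg ha, Real.norm_of_nonneg hb]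
        using dist_add_add_le (a • x) (b • y) (a • x') (b • y')
    have hmem := (convex_Iio (𝕜 := ℝ) (ε / 2)) hxx' hyy' ha hb hab
    exact hle.trans_lt hmem
  refine ⟨z, hz, (dist_triangle _ _ _).trans_lt (add_lt_add hconv hzz') |>.trans_eq ?_⟩
  exact add_halves ε

theorem exists_continuous_cantorSet_range_eq_convex [NormedSpace ℝ V] {X : Set V}
    (hX : IsCompact X) {p : V} (hp : p ∈ X) :
    ∃ Φ : cantorSet → NonemptyCompacts V, Continuous Φ ∧
      Set.range Φ = {K : NonemptyCompacts V | Convex ℝ (K : Set V) ∧ p ∈ K ∧ (K : Set V) ⊆ X} := by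
  let S := {K : NonemptyCompacts V | Convex ℝ (K : Set V) ∧ p ∈ K ∧ (K : Set V) ⊆ X}
  have hclosed : IsClosed {K : NonemptyCompacts V | p ∈ (K : Set V)} := by
    simpa only [Set.inter_singleton_nonempty] using
      NonemptyCompacts.isClosed_inter_nonempty_of_isClosed (isClosed_singleton (x := p))
  have hcompact : IsCompact S := ((NonemptyCompacts.isCompact_subsets_of_isCompact hX).inter_left
    hclosed).inter_left isClosed_setOf_convex_nonemptyCompacts
  have : CompactSpace S := isCompact_iff_compactSpace.1 hcompact
  have : Nonempty S := ⟨{p}, convex_singleton p, rfl, Set.singleton_subset_iff.2 hp⟩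
  obtain ⟨Φ, hΦ, hsurj⟩ := exists_nat_bool_continuous_surjective_of_compact S
  refine ⟨fun t => Φ (cantorSetHomeomorphNatToBool t), continuous_subtype_val.comp
    (hΦ.comp cantorSetHomeomorphNatToBool.continuous), ?_⟩
  have hrange := (hsurj.comp cantorSetHomeomorphNatToBool.surjective).range_comp Subtype.val
  exact hrange.trans Subtype.range_coe

end CantorFamily

section DisjointSums

variable {X ι : Type*} [TopologicalSpace X] {G : ι → X → ℝ} {x : X}

theorem tsum_eventuallyEq_of_forall_ne_notMem_tsupport {k : ι}
    (hfin : ∃ U ∈ 𝓝 x, {i | (tsupport (G i) ∩ U).Nonempty}.Finite)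
    (hx : ∀ i, i ≠ k → x ∉ tsupport (G i)) : (fun y => ∑' i, G i y) =ᶠ[𝓝 x] G k := by
  obtain ⟨U, hU, hfin⟩ := hfin
  have hnear : ∀ᶠ y in 𝓝 x, ∀ i ∈ {i | (tsupport (G i) ∩ U).Nonempty}, i ≠ k → G i y = 0 :=
    (eventually_all_finite hfin).2 fun i _ => eventually_imp_distrib_left.2 fun hik =>
      notMem_tsupport_iff_eventuallyEq.1 (hx i hik)
  filter_upwards [hU, hnear] with y hyU hy
  refine tsum_eq_single k fun i hik => by_contra fun hne => hne (hy i ⟨y, ?_, hyU⟩ hik)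
  exact subset_tsupport _ hne

theorem tsum_eventuallyEq_of_mem_tsupport {k : ι}
    (hdisj : Pairwise fun i j => Disjoint (tsupport (G i)) (tsupport (G j)))
    (hfin : ∃ U ∈ 𝓝 x, {i | (tsupport (G i) ∩ U).Nonempty}.Finite) (hx : x ∈ tsupport (G k)) :
    (fun y => ∑' i, G i y) =ᶠ[𝓝 x] G k :=
  tsum_eventuallyEq_of_forall_ne_notMem_tsupport hfin fun _ hik hxi =>
    (hdisj hik).notMem_of_mem_left hxi hx

theorem exists_tsum_eventuallyEq [Nonempty ι]
    (hdisj : Pairwise fun i j => Disjoint (tsupport (G i)) (tsupport (G j)))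
    (hfin : ∃ U ∈ 𝓝 x, {i | (tsupport (G i) ∩ U).Nonempty}.Finite) :
    ∃ k, (fun y => ∑' i, G i y) =ᶠ[𝓝 x] G k := by
  by_cases hx : ∃ k, x ∈ tsupport (G k)
  · exact hx.imp fun k => tsum_eventuallyEq_of_mem_tsupport hdisj hfin
  · push Not at hx
    obtain ⟨k⟩ := ‹Nonempty ι›
    exact ⟨k, tsum_eventuallyEq_of_forall_ne_notMem_tsupport hfin fun i _ => hx i⟩

theorem hasSum_tsum_of_locallyFinite_tsupport
    (hfin : LocallyFinite fun i => tsupport (G i)) (x : X) :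
    HasSum (fun i => G i x) (∑' i, G i x) :=
  (summable_of_hasFiniteSupport ((hfin.point_finite x).subset fun _ hi =>
    subset_tsupport _ hi)).hasSum

theorem locallyLipschitz_tsum {X ι : Type*} [PseudoMetricSpace X] [Nonempty ι] {G : ι → X → ℝ}
    (hdisj : Pairwise fun i j => Disjoint (tsupport (G i)) (tsupport (G j)))
    (hfin : LocallyFinite fun i => tsupport (G i)) (hG : ∀ i, LocallyLipschitz (G i)) :
    LocallyLipschitz fun x => ∑' i, G i x := by
  intro x
  obtain ⟨k, hk⟩ := exists_tsum_eventuallyEq hdisj (hfin x)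
  obtain ⟨K, t, ht, hKt⟩ := hG k x
  refine ⟨K, t ∩ {y | ∑' i, G i y = G k y}, inter_mem ht hk, fun y hy z hz => ?_⟩
  change edist (∑' i, G i y) (∑' i, G i z) ≤ _
  rw [hy.2, hz.2]
  exact hKt hy.1 hz.1

end DisjointSums

section Stack

variable {V : Type*} [NormedAddCommGroup V] [InnerProductSpace ℝ V]

theorem mem_tsupport_rescale_iff {r : ℝ} (hr : r ≠ 0) {z x : V} {f : V → ℝ} :
    x ∈ tsupport (rescale r z f) ↔ r⁻¹ • (x - z) ∈ tsupport f := by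
  let φ : V ≃ₜ V := (Homeomorph.subRight z).trans (Homeomorph.smulOfNeZero r⁻¹ (inv_ne_zero hr))
  have hsupp : Function.support (rescale r z f) = φ ⁻¹' Function.support f := by
    ext y
    exact mul_ne_zero_iff_left hr
  rw [tsupport, hsupp, ← φ.preimage_closure]
  rfl

theorem exists_pos_forall_mul_norm_le_mul_le {V : Type*} [NormedAddCommGroup V] {f : V → ℝ}
    (hf : Continuous f) (hsupp : HasCompactSupport f) {ε : ℝ} (hε : 0 < ε) :
    ∃ r > 0, (∀ x ∈ tsupport f, r * ‖x‖ ≤ ε) ∧ ∀ x, r * f x ≤ ε := by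
  obtain ⟨R, hR⟩ := hsupp.isCompact.isBounded.exists_norm_le
  obtain ⟨M, hM⟩ := hsupp.exists_bound_of_continuous hf
  have hC : 0 < max 1 (max R M) := lt_max_of_lt_left one_pos
  have hle {t : ℝ} (ht : t ≤ max R M) : ε / max 1 (max R M) * t ≤ ε := by
    rw [div_mul_eq_mul_div]
    exact div_le_of_le_mul₀ hC.le hε.le
      (mul_le_mul_of_nonneg_left (ht.trans (le_max_right _ _)) hε.le)
  exact ⟨ε / max 1 (max R M), div_pos hε hC, fun x hx => hle ((hR x hx).trans (le_max_left _ _)),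
    fun x => hle (((le_abs_self _).trans (hM x)).trans (le_max_right _ _))⟩

/-- The bumps `B k`, shrunk by `r k`, are small enough to be stacked over the base points `c k` of
the hyperplane `e⟂`, the `k`-th one at height `(1/2)^k`. -/
structure IsStack (e : V) (c : ℕ → V) (r : ℕ → ℝ) (B : ℕ → V → ℝ) : Prop where
  norm_eq_one : ‖e‖ = 1
  inner_base : ∀ k, inner ℝ e (c k) = 0
  scale_pos : ∀ k, 0 < r k
  nonneg : ∀ k x, 0 ≤ B k x
  scale_mul_norm_le : ∀ k, ∀ x ∈ tsupport (B k), r k * ‖x‖ ≤ (1 / 2) ^ k / 8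
  scale_mul_le : ∀ k x, r k * B k x ≤ (1 / 4) ^ k

theorem exists_isStack {e : V} {c : ℕ → V} {B : ℕ → V → ℝ} (he : ‖e‖ = 1)
    (hc : ∀ k, inner ℝ e (c k) = 0) (hB : ∀ k, Continuous (B k)) (hnonneg : ∀ k x, 0 ≤ B k x)
    (hsupp : ∀ k, HasCompactSupport (B k)) : ∃ r, IsStack e c r B := by
  choose r hr hnorm hle using fun k => exists_pos_forall_mul_norm_le_mul_le (hB k) (hsupp k)
    (ε := (1 / 4 : ℝ) ^ k / 8) (by positivity)
  refine ⟨r, he, hc, hr, hnonneg, fun k x hx => (hnorm k x hx).trans ?_, fun k x => ?_⟩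
  · gcongr
    norm_num
  · exact (hle k x).trans (div_le_self (by positivity) (by norm_num))

/-- The point at height `(1/2)^k` over `c k`, where the `k`-th bump of a stack is placed. -/
noncomputable def stackCenter (e : V) (c : ℕ → V) (k : ℕ) : V :=
  c k + (1 / 2 : ℝ) ^ k • e

/-- The `k`-th bump of a stack, shrunk and put in its place. -/
noncomputable def stackTerm (e : V) (c : ℕ → V) (r : ℕ → ℝ) (B : ℕ → V → ℝ) (k : ℕ) : V → ℝ :=
  rescale (r k) (stackCenter e c k) (B k)

/-- The sum of the bumps of a stack. Their supports are disjoint, and as they shrink towards the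
hyperplane `e⟂`, gradients of the `B k` accumulate at the cluster points of the base points. -/
noncomputable def stackSum (e : V) (c : ℕ → V) (r : ℕ → ℝ) (B : ℕ → V → ℝ) (x : V) : ℝ :=
  ∑' k, stackTerm e c r B k x

namespace IsStack

variable {e : V} {c : ℕ → V} {r : ℕ → ℝ} {B : ℕ → V → ℝ} {k : ℕ} {u x y : V}

theorem dist_stackCenter_base (h : IsStack e c r B) (k : ℕ) :
    dist (stackCenter e c k) (c k) = (1 / 2) ^ k := by
  rw [stackCenter, dist_self_add_left, norm_smul, h.norm_eq_one, mul_one,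
    Real.norm_of_nonneg (by positivity)]

theorem mem_tsupport_stackTerm_iff (h : IsStack e c r B) :
    u ∈ tsupport (stackTerm e c r B k) ↔ (r k)⁻¹ • (u - stackCenter e c k) ∈ tsupport (B k) :=
  mem_tsupport_rescale_iff (h.scale_pos k).ne'

theorem add_smul_mem_tsupport (h : IsStack e c r B) (hy : y ∈ tsupport (B k)) :
    stackCenter e c k + r k • y ∈ tsupport (stackTerm e c r B k) := by
  rwa [h.mem_tsupport_stackTerm_iff, add_sub_cancel_left, inv_smul_smul₀ (h.scale_pos k).ne']

theorem dist_stackCenter_le (h : IsStack e c r B) (hu : u ∈ tsupport (stackTerm e c r B k)) :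
    dist u (stackCenter e c k) ≤ (1 / 2) ^ k / 8 := by
  have hr := h.scale_pos k
  have hle := h.scale_mul_norm_le k _ (h.mem_tsupport_stackTerm_iff.1 hu)
  rwa [norm_smul, norm_inv, Real.norm_of_nonneg hr.le, mul_inv_cancel_left₀ hr.ne',
    ← dist_eq_norm] at hle

theorem abs_inner_sub_le (h : IsStack e c r B) (u x : V) :
    |inner ℝ e u - inner ℝ e x| ≤ dist u x := by
  rw [← inner_sub_right, dist_eq_norm]
  exact (abs_real_inner_le_norm e (u - x)).trans_eq (by rw [h.norm_eq_one, one_mul])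

theorem abs_inner_sub_pow_le (h : IsStack e c r B) (hu : u ∈ tsupport (stackTerm e c r B k)) :
    |inner ℝ e u - (1 / 2) ^ k| ≤ (1 / 2) ^ k / 8 := by
  have hcenter : inner ℝ e (stackCenter e c k) = (1 / 2 : ℝ) ^ k := by
    rw [stackCenter, inner_add_right, h.inner_base, real_inner_smul_right,
      real_inner_self_eq_norm_sq, h.norm_eq_one, zero_add, one_pow, mul_one]
  have hle := (h.abs_inner_sub_le u _).trans (h.dist_stackCenter_le hu)
  rwa [hcenter] at hle

theorem pow_le_two_mul_dist (h : IsStack e c r B) (hx : inner ℝ e x ≤ 0)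
    (hu : u ∈ tsupport (stackTerm e c r B k)) : (1 / 2) ^ k ≤ 2 * dist u x := by
  have hlow := (abs_le.1 (h.abs_inner_sub_pow_le hu)).1
  have hdist := (le_abs_self _).trans (h.abs_inner_sub_le u x)
  have hpow : (0 : ℝ) < (1 / 2) ^ k := by positivity
  linarith

theorem dist_base_le_four_mul_dist (h : IsStack e c r B) (hx : inner ℝ e x ≤ 0)
    (hu : u ∈ tsupport (stackTerm e c r B k)) : dist (c k) x ≤ 4 * dist u x := by
  have htri := dist_triangle4 (c k) (stackCenter e c k) u x
  rw [dist_comm (c k) (stackCenter e c k), h.dist_stackCenter_base, dist_comm _ u] at htri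
  linarith [h.dist_stackCenter_le hu, h.pow_le_two_mul_dist hx hu, dist_nonneg (x := u) (y := x)]

theorem pairwise_disjoint_tsupport (h : IsStack e c r B) : Pairwise fun i j =>
    Disjoint (tsupport (stackTerm e c r B i)) (tsupport (stackTerm e c r B j)) := by
  refine (pairwise_disjoint_on _).2 fun i j hij => Set.disjoint_left.2 fun u hi hj => ?_
  have hpow : (1 / 2 : ℝ) ^ j ≤ (1 / 2) ^ (i + 1) :=
    pow_le_pow_of_le_one (by norm_num) (by norm_num) hij
  have hpos : (0 : ℝ) < (1 / 2) ^ i := by positivity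
  rw [pow_succ] at hpow
  linarith [(abs_le.1 (h.abs_inner_sub_pow_le hi)).1, (abs_le.1 (h.abs_inner_sub_pow_le hj)).2]

theorem locallyFinite_tsupport_at (h : IsStack e c r B) (hx : 0 < inner ℝ e x) :
    ∃ U ∈ 𝓝 x, {k | (tsupport (stackTerm e c r B k) ∩ U).Nonempty}.Finite := by
  obtain ⟨n, hn⟩ := exists_pow_lt_of_lt_one (div_pos hx four_pos) (one_half_lt_one (α := ℝ))
  refine ⟨{y | inner ℝ e x / 2 < inner ℝ e y}, ?_, (Set.finite_Iio n).subset ?_⟩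
  · exact (isOpen_lt continuous_const (by fun_prop)).mem_nhds (half_lt_self hx)
  · rintro k ⟨u, hu, hxu : inner ℝ e x / 2 < inner ℝ e u⟩
    by_contra hnk
    have hpow : (1 / 2 : ℝ) ^ k ≤ (1 / 2) ^ n :=
      pow_le_pow_of_le_one (by norm_num) (by norm_num) (not_lt.1 hnk)
    linarith [(abs_le.1 (h.abs_inner_sub_pow_le hu)).2]

theorem inner_pos_of_mem_tsupport (h : IsStack e c r B)
    (hu : u ∈ tsupport (stackTerm e c r B k)) : 0 < inner ℝ e u := by
  have hpow : (0 : ℝ) < (1 / 2) ^ k := by positivity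
  linarith [(abs_le.1 (h.abs_inner_sub_pow_le hu)).1]

theorem exists_stackSum_eventuallyEq (h : IsStack e c r B) (hx : 0 < inner ℝ e x) :
    ∃ k, stackSum e c r B =ᶠ[𝓝 x] stackTerm e c r B k :=
  exists_tsum_eventuallyEq h.pairwise_disjoint_tsupport (h.locallyFinite_tsupport_at hx)

theorem stackSum_eventuallyEq (h : IsStack e c r B) (hu : u ∈ tsupport (stackTerm e c r B k)) :
    stackSum e c r B =ᶠ[𝓝 u] stackTerm e c r B k :=
  tsum_eventuallyEq_of_mem_tsupport h.pairwise_disjoint_tsupport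
    (h.locallyFinite_tsupport_at (h.inner_pos_of_mem_tsupport hu)) hu

theorem stackSum_nonneg (h : IsStack e c r B) (x : V) : 0 ≤ stackSum e c r B x :=
  tsum_nonneg fun k => mul_nonneg (h.scale_pos k).le (h.nonneg k _)

theorem exists_mem_tsupport_of_stackSum_ne_zero (hu : stackSum e c r B u ≠ 0) :
    ∃ k, u ∈ tsupport (stackTerm e c r B k) := by
  contrapose! hu
  exact (tsum_congr fun k => image_eq_zero_of_notMem_tsupport (hu k)).trans tsum_zero

theorem stackSum_eq_zero (h : IsStack e c r B) (hx : inner ℝ e x ≤ 0) :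
    stackSum e c r B x = 0 := by
  by_contra hne
  obtain ⟨k, hk⟩ := exists_mem_tsupport_of_stackSum_ne_zero hne
  exact hx.not_gt (h.inner_pos_of_mem_tsupport hk)

theorem stackSum_le (h : IsStack e c r B) (hx : inner ℝ e x ≤ 0) (u : V) :
    stackSum e c r B u ≤ 4 * dist u x ^ 2 := by
  by_cases hu : stackSum e c r B u = 0
  · rw [hu]
    positivity
  · obtain ⟨k, hk⟩ := exists_mem_tsupport_of_stackSum_ne_zero hu
    calc stackSum e c r B u = stackTerm e c r B k u := (h.stackSum_eventuallyEq hk).eq_of_nhds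
      _ ≤ (1 / 4) ^ k := h.scale_mul_le k _
      _ = ((1 / 2) ^ k) ^ 2 := by rw [← pow_mul, mul_comm, pow_mul]; norm_num
      _ ≤ (2 * dist u x) ^ 2 := pow_le_pow_left₀ (by positivity) (h.pow_le_two_mul_dist hx hk) 2
      _ = 4 * dist u x ^ 2 := by ring

theorem tsupport_stackSum_subset (h : IsStack e c r B) {M : ℝ} (hM : ∀ k, ‖c k‖ ≤ M) :
    tsupport (stackSum e c r B) ⊆ Metric.closedBall 0 (M + 2) := by
  refine closure_minimal (fun u hu => ?_) Metric.isClosed_closedBall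
  obtain ⟨k, hk⟩ := exists_mem_tsupport_of_stackSum_ne_zero hu
  have hpow : (1 / 2 : ℝ) ^ k ≤ 1 := pow_le_one₀ (by norm_num) (by norm_num)
  have htri := dist_triangle4 u (stackCenter e c k) (c k) 0
  rw [h.dist_stackCenter_base, dist_zero_right (c k)] at htri
  rw [Metric.mem_closedBall]
  linarith [h.dist_stackCenter_le hk, hM k]

variable [CompleteSpace V]

theorem hasGradientAt_stackSum_zero (h : IsStack e c r B) (hx : inner ℝ e x ≤ 0) :
    HasGradientAt (stackSum e c r B) 0 x := by
  rw [hasGradientAt_iff_isLittleO]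
  simp only [h.stackSum_eq_zero hx, inner_zero_left, sub_zero]
  have hbigO : stackSum e c r B =O[𝓝 x] fun y => ‖y - x‖ ^ 2 := by
    refine Asymptotics.IsBigO.of_bound 4 (.of_forall fun y => ?_)
    rw [Real.norm_of_nonneg (h.stackSum_nonneg y), norm_pow, norm_norm, ← dist_eq_norm]
    exact h.stackSum_le hx y
  exact hbigO.trans_isLittleO ((Asymptotics.isLittleO_norm_pow_id one_lt_two).comp_tendsto
    (tendsto_sub_nhds_zero_iff.2 tendsto_id))

theorem gradient_stackTerm (h : IsStack e c r B) (k : ℕ) (u : V) :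
    gradient (stackTerm e c r B k) u = gradient (B k) ((r k)⁻¹ • (u - stackCenter e c k)) :=
  gradient_rescale (h.scale_pos k).ne' _ _ u

theorem gradient_stackSum_add_smul (h : IsStack e c r B) (hy : y ∈ tsupport (B k)) :
    gradient (stackSum e c r B) (stackCenter e c k + r k • y) = gradient (B k) y := by
  rw [(h.stackSum_eventuallyEq (h.add_smul_mem_tsupport hy)).gradient_eq, h.gradient_stackTerm,
    add_sub_cancel_left, inv_smul_smul₀ (h.scale_pos k).ne']

theorem gradientCluster_stackSum_add_smul (h : IsStack e c r B) (hy : y ∈ tsupport (B k)) :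
    gradientCluster (stackSum e c r B) (stackCenter e c k + r k • y) =
      gradientCluster (B k) y := by
  rw [gradientCluster_congr (h.stackSum_eventuallyEq (h.add_smul_mem_tsupport hy)), stackTerm,
    gradientCluster_rescale (h.scale_pos k).ne', add_sub_cancel_left,
    inv_smul_smul₀ (h.scale_pos k).ne']

theorem gradient_stackSum_eq_zero_or (h : IsStack e c r B) (u : V) :
    gradient (stackSum e c r B) u = 0 ∨ ∃ k y, u ∈ tsupport (stackTerm e c r B k) ∧
      gradient (stackSum e c r B) u = gradient (B k) y := by
  rcases le_or_gt (inner ℝ e u) 0 with hu | hu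
  · exact Or.inl (h.hasGradientAt_stackSum_zero hu).gradient
  · obtain ⟨k, hk⟩ := h.exists_stackSum_eventuallyEq hu
    by_cases hmem : u ∈ tsupport (stackTerm e c r B k)
    · exact Or.inr ⟨k, _, hmem, hk.gradient_eq.trans (h.gradient_stackTerm k u)⟩
    · exact Or.inl (hk.gradient_eq.trans (gradient_eq_zero_of_notMem_tsupport hmem))

theorem mem_gradientCluster_stackSum_iff (h : IsStack e c r B) (hx : inner ℝ e x ≤ 0) {q : V} :
    q ∈ gradientCluster (stackSum e c r B) x ↔ q = 0 ∨ ∀ ε > 0, ∃ k y,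
      (1 / 2) ^ k < ε ∧ dist (c k) x < ε ∧ dist (gradient (B k) y) q < ε := by
  have hgrad := (h.hasGradientAt_stackSum_zero hx).gradient
  rw [mem_gradientCluster_iff_forall_exists_dist_lt]
  refine ⟨fun hq => or_iff_not_imp_left.2 fun hq₀ ε hε => ?_, ?_⟩
  · obtain ⟨u, hux, huq⟩ := hq (min (ε / 4) ‖q‖) (lt_min (by positivity) (norm_pos_iff.2 hq₀))
    obtain ⟨hux, -⟩ := lt_min_iff.1 hux
    obtain ⟨huε, huq⟩ := lt_min_iff.1 huq
    rcases h.gradient_stackSum_eq_zero_or u with hu | ⟨k, y, hu, hy⟩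
    · rw [hu, dist_zero_left] at huq
      exact absurd huq (lt_irrefl _)
    · refine ⟨k, y, ?_, ?_, hy ▸ huε.trans (by linarith)⟩
      · linarith [h.pow_le_two_mul_dist hx hu]
      · linarith [h.dist_base_le_four_mul_dist hx hu]
  · rintro (rfl | hq) ε hε
    · exact ⟨x, by simpa only [dist_self] using hε, by simpa only [hgrad, dist_self] using hε⟩
    · obtain ⟨k, y, hpow, hcx, hyq⟩ := hq (ε / 4) (by positivity)
      by_cases hy : y ∈ tsupport (B k)
      · refine ⟨stackCenter e c k + r k • y, ?_, ?_⟩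
        · have htri := dist_triangle4 (stackCenter e c k + r k • y) (stackCenter e c k) (c k) x
          rw [h.dist_stackCenter_base] at htri
          linarith [h.dist_stackCenter_le (h.add_smul_mem_tsupport hy)]
        · rw [h.gradient_stackSum_add_smul hy]
          linarith
      · rw [gradient_eq_zero_of_notMem_tsupport hy] at hyq
        exact ⟨x, by simpa only [dist_self] using hε, hgrad ▸ hyq.trans (by linarith)⟩

theorem gradientCluster_stackSum_eq_zero (h : IsStack e c r B) (hx : inner ℝ e x ≤ 0)
    (hxc : x ∉ closure (Set.range c)) : gradientCluster (stackSum e c r B) x = {0} := by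
  refine Set.eq_singleton_iff_unique_mem.2
    ⟨(h.mem_gradientCluster_stackSum_iff hx).2 (Or.inl rfl), fun q hq => ?_⟩
  refine ((h.mem_gradientCluster_stackSum_iff hx).1 hq).resolve_right fun hq => hxc ?_
  refine Metric.mem_closure_range_iff.2 fun ε hε => ?_
  obtain ⟨k, -, -, hk, -⟩ := hq ε hε
  exact ⟨k, dist_comm x (c k) ▸ hk⟩

theorem isTameAt_stackSum (h : IsStack e c r B) (hB : ∀ k y, IsTameAt (B k) y)
    (hconv : inner ℝ e x ≤ 0 → Convex ℝ (gradientCluster (stackSum e c r B) x)) :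
    IsTameAt (stackSum e c r B) x := by
  rcases le_or_gt (inner ℝ e x) 0 with hx | hx
  · exact ⟨(h.hasGradientAt_stackSum_zero hx).differentiableAt, hconv hx, fun _ => 0,
      contDiffAt_const, .of_forall h.stackSum_nonneg, (h.stackSum_eq_zero hx).symm⟩
  · obtain ⟨k, hk⟩ := h.exists_stackSum_eventuallyEq hx
    exact IsTameAt.congr ((hB k _).rescale (h.scale_pos k)) hk

end IsStack

end Stack

section Pieces

open TopologicalSpace

variable {V : Type*} [NormedAddCommGroup V] [InnerProductSpace ℝ V]

theorem gradientCluster_stackSum_eq_of_continuous [CompleteSpace V] {T : Type*}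
    [TopologicalSpace T] {ι : T → V} (hι : IsInducing ι) {d : ℕ → T}
    (hd : ∀ t, MapClusterPt t atTop d) {Φ : T → NonemptyCompacts V} (hΦ : Continuous Φ)
    {e : V} {r : ℕ → ℝ} {B : ℕ → V → ℝ} (h : IsStack e (fun k => ι (d k)) r B)
    (hnear : ∀ k y, ∃ q ∈ Φ (d k), dist (gradient (B k) y) q ≤ (1 / 2) ^ k)
    (hdense : ∀ k, ∀ q ∈ Φ (d k), ∃ y, dist (gradient (B k) y) q ≤ (1 / 2) ^ k)
    {t : T} (ht : inner ℝ e (ι t) = 0) (h₀ : 0 ∈ Φ t) :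
    gradientCluster (stackSum e (fun k => ι (d k)) r B) (ι t) = Φ t := by
  ext q
  rw [h.mem_gradientCluster_stackSum_iff ht.le]
  constructor
  · rintro (rfl | hq)
    · exact h₀
    · refine (Φ t).isCompact.isClosed.closure_subset (Metric.mem_closure_iff.2 fun ε hε => ?_)
      have hΦt : ∀ᶠ s in 𝓝 t, dist (Φ s) (Φ t) < ε / 3 :=
        Metric.tendsto_nhds.1 hΦ.continuousAt _ (by positivity)
      rw [hι.nhds_eq_comap, (Metric.nhds_basis_ball.comap ι).eventually_iff] at hΦt
      obtain ⟨δ, hδ, hΦδ⟩ := hΦt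
      obtain ⟨k, y, hpow, hdk, hyq⟩ := hq (min δ (ε / 3)) (lt_min hδ (by positivity))
      obtain ⟨q₁, hq₁, hyq₁⟩ := hnear k y
      obtain ⟨q₂, hq₂, hq₁₂⟩ := exists_dist_lt_of_nonemptyCompacts_dist_lt
        (hΦδ (hdk.trans_le (min_le_left _ _))) hq₁
      have htri := dist_triangle4 q (gradient (B k) y) q₁ q₂
      rw [dist_comm q (gradient (B k) y)] at htri
      exact ⟨q₂, hq₂, by linarith [min_le_right δ (ε / 3)]⟩
  · refine fun hq => Or.inr fun ε hε => ?_
    have hpow : ∀ᶠ k : ℕ in atTop, (1 / 2 : ℝ) ^ k < ε / 2 :=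
      (tendsto_pow_atTop_nhds_zero_of_lt_one (by norm_num) (by norm_num)).eventually_lt_const
        (half_pos hε)
    have hΦt : ∀ᶠ s in 𝓝 t, dist (Φ s) (Φ t) < ε / 2 ∧ dist (ι s) (ι t) < ε :=
      (Metric.tendsto_nhds.1 hΦ.continuousAt _ (half_pos hε)).and
        (Metric.tendsto_nhds.1 hι.continuous.continuousAt _ hε)
    obtain ⟨k, ⟨hΦk, hdk⟩, hk⟩ := (((hd t).frequently hΦt).and_eventually hpow).exists
    obtain ⟨q₁, hq₁, hqq₁⟩ := exists_dist_lt_of_nonemptyCompacts_dist_lt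
      (dist_comm (Φ (d k)) (Φ t) ▸ hΦk) hq
    obtain ⟨y, hy⟩ := hdense k q₁ hq₁
    refine ⟨k, y, by linarith, hdk, ?_⟩
    linarith [dist_triangle_right (gradient (B k) y) q q₁]

variable [FiniteDimensional ℝ V] {e₁ e₂ : V}

theorem exists_forall_gradientCluster_eq {T : Type*} [TopologicalSpace T] [SeparableSpace T]
    [Nonempty T] {ι : T → V} (hι : IsClosedEmbedding ι) {e : V} (he : ‖e‖ = 1)
    (hbase : ∀ t, inner ℝ e (ι t) = 0) (hnorm : ∀ t, ‖ι t‖ ≤ 1) {X : Set V} (hX : IsCompact X)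
    (hXconv : Convex ℝ X) (hX₀ : X ∈ 𝓝 0) {Φ : T → NonemptyCompacts V} (hΦ : Continuous Φ)
    (hΦconv : ∀ t, Convex ℝ (Φ t : Set V)) (hΦ₀ : ∀ t, 0 ∈ Φ t) (hΦX : ∀ t, (Φ t : Set V) ⊆ X) :
    ∃ S : V → ℝ, (∀ x, IsTameAt S x) ∧ (∀ x, 0 ≤ S x) ∧ tsupport S ⊆ Metric.closedBall 0 3 ∧
      (∀ x, gradient S x ∈ X) ∧ gradient S 0 = 0 ∧ ∀ t, gradientCluster S (ι t) = Φ t := by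
  obtain ⟨d, hd⟩ := exists_seq_forall_mapClusterPt T
  choose B hB hBnonneg hBsupp hBnear hBdense using fun k =>
    exists_contDiff_gradient_dense hX hXconv hX₀ (Φ (d k)).isCompact (hΦconv (d k))
      (hΦ₀ (d k)) (hΦX (d k)) (δ := (1 / 2) ^ k) (by positivity)
  obtain ⟨r, hstack⟩ := exists_isStack he (fun k => hbase (d k)) (fun k => (hB k).continuous)
    hBnonneg hBsupp
  have hcluster (t : T) : gradientCluster (stackSum e (fun k => ι (d k)) r B) (ι t) = Φ t :=
    gradientCluster_stackSum_eq_of_continuous hι.isInducing hd hΦ hstack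
      (fun k y => (hBnear k y).2) hBdense (hbase t) (hΦ₀ t)
  refine ⟨stackSum e (fun k => ι (d k)) r B, fun x => ?_, hstack.stackSum_nonneg,
    (hstack.tsupport_stackSum_subset fun k => hnorm (d k)).trans_eq (by norm_num), fun x => ?_,
    (hstack.hasGradientAt_stackSum_zero (inner_zero_right _).le).gradient, hcluster⟩
  · refine hstack.isTameAt_stackSum (fun k y => isTameAt_of_contDiffAt (hB k).contDiffAt)
      fun hx => ?_
    by_cases hxι : x ∈ Set.range ι
    · obtain ⟨t, rfl⟩ := hxι
      exact hcluster t ▸ hΦconv t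
    · have hsub : closure (Set.range fun k => ι (d k)) ⊆ Set.range ι :=
        closure_minimal (Set.range_comp_subset_range d ι) hι.isClosed_range
      rw [hstack.gradientCluster_stackSum_eq_zero hx fun hmem => hxι (hsub hmem)]
      exact convex_singleton 0
  · rcases hstack.gradient_stackSum_eq_zero_or x with h | ⟨k, y, -, h⟩
    · exact h ▸ mem_of_mem_nhds hX₀
    · exact h ▸ (hBnear k y).1

theorem exists_gradientCluster_eq_of_zero_mem (he₁ : ‖e₁‖ = 1) (he₂ : ‖e₂‖ = 1)
    (h₁₂ : inner ℝ e₂ e₁ = 0) {X : Set V} (hX : IsCompact X) (hXconv : Convex ℝ X)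
    (hX₀ : X ∈ 𝓝 0) :
    ∃ S : V → ℝ, (∀ x, IsTameAt S x) ∧ (∀ x, 0 ≤ S x) ∧ tsupport S ⊆ Metric.closedBall 0 3 ∧
      (∀ x, gradient S x ∈ X) ∧ gradient S 0 = 0 ∧
      ∀ K, IsCompact K → Convex ℝ K → 0 ∈ K → K ⊆ X →
        ∃ x ∈ Metric.closedBall 0 1, gradientCluster S x = K := by
  obtain ⟨Φ, hΦ, hrange⟩ :=
    exists_continuous_cantorSet_range_eq_convex hX (mem_of_mem_nhds hX₀)
  have hmem (t : cantorSet) : Convex ℝ (Φ t : Set V) ∧ 0 ∈ Φ t ∧ (Φ t : Set V) ⊆ X :=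
    hrange.subset (Set.mem_range_self t)
  have : Nonempty cantorSet := ⟨⟨0, zero_mem_cantorSet⟩⟩
  let ι (t : cantorSet) : V := (t : ℝ) • e₁
  have hι : IsClosedEmbedding ι :=
    (isClosedEmbedding_smul_left (norm_ne_zero_iff.1 (he₁ ▸ one_ne_zero))).comp
      isClosed_cantorSet.isClosedEmbedding_subtypeVal
  have hbase (t : cantorSet) : inner ℝ e₂ (ι t) = 0 := by
    rw [real_inner_smul_right, h₁₂, mul_zero]
  have hnorm (t : cantorSet) : ‖ι t‖ ≤ 1 := by
    obtain ⟨h0, h1⟩ := cantorSet_subset_unitInterval t.2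
    rwa [norm_smul, he₁, mul_one, Real.norm_of_nonneg h0]
  obtain ⟨S, hS, hnonneg, hsupp, hgrad, hgrad₀, hcluster⟩ :=
    exists_forall_gradientCluster_eq hι he₂ hbase hnorm hX hXconv hX₀ hΦ
      (fun t => (hmem t).1) (fun t => (hmem t).2.1) (fun t => (hmem t).2.2)
  refine ⟨S, hS, hnonneg, hsupp, hgrad, hgrad₀, fun K hK hKconv hK₀ hKX => ?_⟩
  obtain ⟨t, ht⟩ := hrange.ge
    (show (⟨⟨K, hK⟩, 0, hK₀⟩ : NonemptyCompacts V) ∈ _ from ⟨hKconv, hK₀, hKX⟩)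
  exact ⟨ι t, mem_closedBall_zero_iff.2 (hnorm t),
    (hcluster t).trans (congrArg SetLike.coe ht)⟩

/-- A nonnegative, compactly supported, `L`-Lipschitz function which is tame at every point. -/
structure IsTameBump (L : NNReal) (f : V → ℝ) : Prop where
  isTameAt : ∀ x, IsTameAt f x
  nonneg : ∀ x, 0 ≤ f x
  hasCompactSupport : HasCompactSupport f
  lipschitzWith : LipschitzWith L f

namespace IsTameBump

variable {L : NNReal} {f : V → ℝ}

theorem differentiable (hf : IsTameBump L f) : Differentiable ℝ f :=
  fun x => (hf.isTameAt x).differentiableAt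

theorem norm_gradient_le (hf : IsTameBump L f) (x : V) : ‖gradient f x‖ ≤ L :=
  (lipschitzWith_iff_norm_gradient_le hf.differentiable).1 hf.lipschitzWith x

end IsTameBump

theorem exists_isTameBump_gradientCluster_eq_of_mem (he₁ : ‖e₁‖ = 1) (he₂ : ‖e₂‖ = 1)
    (h₁₂ : inner ℝ e₂ e₁ = 0) {p : V} (hp : ‖p‖ < 1) :
    ∃ F : V → ℝ, IsTameBump 1 F ∧ gradient F 0 = p ∧
      ∀ K, IsCompact K → Convex ℝ K → p ∈ K → K ⊆ Metric.closedBall 0 1 →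
        ∃ x, gradientCluster F x = K := by
  obtain ⟨A, hA, hAnonneg, hAsupp, hAlip, hAgrad⟩ :=
    exists_lipschitzWith_gradient_eq hp.le zero_le_four
  have hX₀ : Metric.closedBall (-p) 1 ∈ 𝓝 0 := Metric.closedBall_mem_nhds_of_mem
    (by rwa [Metric.mem_ball, dist_zero_left, norm_neg])
  obtain ⟨S, hS, hSnonneg, hSsupp, hSgrad, hS₀, hSK⟩ :=
    exists_gradientCluster_eq_of_zero_mem he₁ he₂ h₁₂ (isCompact_closedBall (-p) 1)
      (convex_closedBall (-p) 1) hX₀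
  have hAd := hA.differentiable one_ne_zero
  have hSd (x : V) : DifferentiableAt ℝ S x := (hS x).differentiableAt
  have hgrad (x : V) : gradient (fun y => A y + S y) x = gradient A x + gradient S x :=
    gradient_add (hAd x) (hSd x)
  refine ⟨fun x => A x + S x, ⟨fun x => (hS x).contDiffAt_add hA.contDiffAt (.of_forall hSd),
    fun x => add_nonneg (hAnonneg x) (hSnonneg x), hAsupp.add ?_, ?_⟩, ?_,
    fun K hK hKconv hpK hK₁ => ?_⟩
  · exact (isCompact_closedBall 0 3).of_isClosed_subset (isClosed_tsupport S) hSsupp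
  · refine (lipschitzWith_iff_norm_gradient_le fun x => (hAd x).add (hSd x)).2 fun x => ?_
    change ‖gradient (fun y => A y + S y) x‖ ≤ 1
    rw [hgrad]
    by_cases hx : x ∈ tsupport S
    · rw [hAgrad x (Metric.closedBall_subset_ball (by norm_num) (hSsupp hx)), add_comm,
        ← sub_neg_eq_add, ← dist_eq_norm]
      exact hSgrad x
    · rw [gradient_eq_zero_of_notMem_tsupport hx, add_zero]
      exact (lipschitzWith_iff_norm_gradient_le hAd).1 hAlip x
  · rw [hgrad, hAgrad 0 (Metric.mem_ball_self four_pos), hS₀, add_zero]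
  · obtain ⟨x, hx, hxK⟩ := hSK ((p + ·) ⁻¹' K)
      ((Homeomorph.addLeft p).isCompact_preimage.2 hK) (hKconv.translate_preimage_right p)
      (by rwa [Set.mem_preimage, add_zero]) fun v hv => by
        simpa only [Metric.mem_closedBall, dist_eq_norm, sub_zero, sub_neg_eq_add, add_comm v]
          using hK₁ hv
    refine ⟨x, ?_⟩
    rw [gradientCluster_add hA.contDiffAt (.of_forall hSd), hxK,
      hAgrad x (Metric.closedBall_subset_ball (by norm_num) hx)]
    exact Set.image_preimage_eq K (add_left_surjective p)

end Pieces

section Universal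

variable {V : Type*} [NormedAddCommGroup V] [InnerProductSpace ℝ V]

/-- Every convex body contained in the closed ball of radius `L` about the origin is the set of
limiting gradients of `f` at some point. -/
def RealizesConvexBodies [CompleteSpace V] (L : ℝ) (f : V → ℝ) : Prop :=
  ∀ K : Set V, IsCompact K → Convex ℝ K → (interior K).Nonempty → K ⊆ Metric.closedBall 0 L →
    ∃ x, gradientCluster f x = K

theorem mem_tsupport_of_interior_gradientCluster_nonempty [CompleteSpace V] [Nontrivial V]
    {f : V → ℝ} {x : V} (h : (interior (gradientCluster f x)).Nonempty) : x ∈ tsupport f := by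
  by_contra hx
  rw [gradientCluster_eq_zero_of_notMem_tsupport hx, interior_singleton] at h
  exact Set.not_nonempty_empty h

theorem IsStack.gradientCluster_stackSum_eq_closedBall [CompleteSpace V] {e : V} {r : ℕ → ℝ}
    {B : ℕ → V → ℝ} (h : IsStack e (fun _ => 0) r B) {L : ℝ} (hL : L ≠ 0)
    (hB : ∀ k y, ‖gradient (B k) y‖ ≤ L)
    (hdense : ∀ p ∈ Metric.ball 0 L, MapClusterPt p atTop fun k => gradient (B k) 0) :
    gradientCluster (stackSum e (fun _ => 0) r B) 0 = Metric.closedBall 0 L := by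
  have h₀ : inner ℝ e (0 : V) ≤ 0 := (inner_zero_right e).le
  refine Set.Subset.antisymm (fun q hq => ?_) ?_
  · refine mem_closedBall_zero_iff.2 (le_of_forall_pos_le_add fun ε hε => ?_)
    rcases (h.mem_gradientCluster_stackSum_iff h₀).1 hq with rfl | hq
    · rw [norm_zero]
      linarith [(norm_nonneg _).trans (hB 0 0)]
    · obtain ⟨k, y, -, -, hyq⟩ := hq ε hε
      linarith [norm_le_norm_add_norm_sub (gradient (B k) y) q, hB k y,
        dist_eq_norm (gradient (B k) y) q]
  · rw [← closure_ball _ hL]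
    refine closure_minimal (fun p hp => (h.mem_gradientCluster_stackSum_iff h₀).2 ?_)
      isClosed_setOfPred_clusterPt
    refine Or.inr fun ε hε => ?_
    have hpow : ∀ᶠ k : ℕ in atTop, (1 / 2 : ℝ) ^ k < ε :=
      (tendsto_pow_atTop_nhds_zero_of_lt_one (by norm_num) (by norm_num)).eventually_lt_const hε
    obtain ⟨k, hkp, hk⟩ := (((hdense p hp).frequently (Metric.ball_mem_nhds p hε)).and_eventually
      hpow).exists
    exact ⟨k, 0, hk, (dist_self 0).trans_lt hε, hkp⟩

variable [FiniteDimensional ℝ V] {L : NNReal}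

theorem IsStack.isTameBump_stackSum {e : V} {c : ℕ → V} {r : ℕ → ℝ} {B : ℕ → V → ℝ}
    (h : IsStack e c r B) (hc : Bornology.IsBounded (Set.range c))
    (hB : ∀ k, IsTameBump L (B k))
    (hconv : ∀ x, inner ℝ e x ≤ 0 → Convex ℝ (gradientCluster (stackSum e c r B) x)) :
    IsTameBump L (stackSum e c r B) := by
  have htame (x : V) : IsTameAt (stackSum e c r B) x :=
    h.isTameAt_stackSum (fun k => (hB k).isTameAt) (hconv x)
  obtain ⟨M, hM⟩ := hc.exists_norm_le
  refine ⟨htame, h.stackSum_nonneg, ?_, ?_⟩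
  · exact (isCompact_closedBall 0 (M + 2)).of_isClosed_subset (isClosed_tsupport _)
      (h.tsupport_stackSum_subset fun k => hM _ (Set.mem_range_self k))
  · refine (lipschitzWith_iff_norm_gradient_le fun x => (htame x).differentiableAt).2 fun x => ?_
    rcases h.gradient_stackSum_eq_zero_or x with hx | ⟨k, y, -, hx⟩
    · rw [hx, norm_zero]
      exact L.coe_nonneg
    · exact hx ▸ (hB k).norm_gradient_le y

theorem exists_isTameBump_realizesConvexBodies {e₁ e₂ : V} (he₁ : ‖e₁‖ = 1) (he₂ : ‖e₂‖ = 1)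
    (h₁₂ : inner ℝ e₂ e₁ = 0) : ∃ f : V → ℝ, IsTameBump 1 f ∧ RealizesConvexBodies 1 f := by
  have : Nontrivial V := ⟨e₁, 0, norm_ne_zero_iff.1 (he₁ ▸ one_ne_zero)⟩
  have : Nonempty (Metric.ball (0 : V) 1) := ⟨0, Metric.mem_ball_self one_pos⟩
  obtain ⟨d, hd⟩ := exists_seq_forall_mapClusterPt (Metric.ball (0 : V) 1)
  choose B hB hgrad hBK using fun k => exists_isTameBump_gradientCluster_eq_of_mem he₁ he₂ h₁₂
    (mem_ball_zero_iff.1 (d k).2)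
  obtain ⟨r, h⟩ := exists_isStack (c := fun _ => 0) he₂ (fun _ => inner_zero_right e₂)
    (fun k => (hB k).lipschitzWith.continuous) (fun k => (hB k).nonneg)
    (fun k => (hB k).hasCompactSupport)
  have hcluster : gradientCluster (stackSum e₂ (fun _ => 0) r B) 0 = Metric.closedBall 0 1 :=
    h.gradientCluster_stackSum_eq_closedBall one_ne_zero (fun k => (hB k).norm_gradient_le)
      fun p hp => by
        simpa only [hgrad, Function.comp_def] using
          (hd ⟨p, hp⟩).continuousAt_comp continuous_subtype_val.continuousAt
  refine ⟨stackSum e₂ (fun _ => 0) r B, h.isTameBump_stackSum ?_ hB fun x hx => ?_,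
    fun K hK hKconv ⟨p, hpK⟩ hK₁ => ?_⟩
  · exact Bornology.isBounded_singleton.subset Set.range_const_subset
  · by_cases hx₀ : x = 0
    · rw [hx₀, hcluster]
      exact convex_closedBall 0 1
    · rw [h.gradientCluster_stackSum_eq_zero hx (by simpa only [Set.range_const,
        closure_singleton, Set.mem_singleton_iff] using hx₀)]
      exact convex_singleton 0
  · have hp₁ : p ∈ Metric.ball (0 : V) 1 := interior_closedBall (0 : V) one_ne_zero ▸
      interior_mono hK₁ hpK
    obtain ⟨k, hk⟩ := ((hd ⟨p, hp₁⟩).frequently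
      (continuous_subtype_val.continuousAt.preimage_mem_nhds
        (isOpen_interior.mem_nhds hpK))).exists
    obtain ⟨y, hy⟩ := hBK k K hK hKconv (interior_subset hk) hK₁
    have hyB : y ∈ tsupport (B k) :=
      mem_tsupport_of_interior_gradientCluster_nonempty (hy.symm ▸ ⟨p, hpK⟩)
    exact ⟨_, (h.gradientCluster_stackSum_add_smul hyB).trans hy⟩

end Universal

section Separation

theorem exists_pairwise_disjoint_locallyFinite_closedBall (V : Type*) [NormedAddCommGroup V]
    [NormedSpace ℝ V] [Nontrivial V] (R : ℝ) :
    ∃ c : ℕ → V,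
      (Pairwise fun i j => Disjoint (Metric.closedBall (c i) R) (Metric.closedBall (c j) R)) ∧
        LocallyFinite fun n => Metric.closedBall (c n) R := by
  obtain ⟨e, he⟩ := exists_norm_eq V (abs_nonneg (2 * |R| + 1))
  rw [abs_of_pos (by positivity)] at he
  refine ⟨fun n => (n : ℝ) • e, fun i j hij => Metric.closedBall_disjoint_closedBall ?_,
    fun x => ⟨Metric.ball x 1, Metric.ball_mem_nhds x one_pos, ?_⟩⟩
  · have hone : (1 : ℝ) ≤ |(i : ℝ) - j| := by
      exact_mod_cast Int.one_le_abs (sub_ne_zero.2 (Nat.cast_injective.ne hij))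
    rw [dist_eq_norm, ← sub_smul, norm_smul, he, Real.norm_eq_abs]
    calc R + R ≤ |R| + |R| := add_le_add (le_abs_self R) (le_abs_self R)
      _ < 1 * (2 * |R| + 1) := by linarith
      _ ≤ |(i : ℝ) - j| * (2 * |R| + 1) := by gcongr
  · obtain ⟨m, hm⟩ := exists_nat_ge (R + 1 + ‖x‖)
    refine (Set.finite_Iic m).subset ?_
    rintro n ⟨y, hyn, hyx⟩
    have hn : ‖(n : ℝ) • e‖ ≤ R + 1 + ‖x‖ := by
      have htri := dist_triangle4 ((n : ℝ) • e) y x 0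
      rw [dist_comm _ y, dist_zero_right, dist_zero_right] at htri
      linarith [Metric.mem_closedBall.1 hyn, Metric.mem_ball.1 hyx]
    rw [norm_smul, he, Real.norm_natCast] at hn
    have hle : (n : ℝ) ≤ n * (2 * |R| + 1) :=
      le_mul_of_one_le_right n.cast_nonneg (by linarith [abs_nonneg R])
    exact_mod_cast (hle.trans hn).trans hm

end Separation

section Family

open Pointwise

variable {V : Type*} [NormedAddCommGroup V] [InnerProductSpace ℝ V]

section Complete

variable [CompleteSpace V] {L : ℝ} {f : V → ℝ}

theorem RealizesConvexBodies.const_mul (hf : RealizesConvexBodies L f) {a : ℝ} (ha : 0 < a) :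
    RealizesConvexBodies (a * L) fun x => a * f x := by
  intro K hK hKconv hKint hKL
  obtain ⟨x, hx⟩ := hf (a⁻¹ • K) (hK.smul a⁻¹) (hKconv.smul a⁻¹)
    (interior_smul₀ (inv_ne_zero ha.ne') K ▸ hKint.smul_set) fun v hv => by
      have hav := mem_closedBall_zero_iff.1 (hKL ((Set.mem_inv_smul_set_iff₀ ha.ne' K v).1 hv))
      rw [norm_smul, Real.norm_of_nonneg ha.le] at hav
      exact mem_closedBall_zero_iff.2 (le_of_mul_le_mul_left hav ha)
  exact ⟨x, (gradientCluster_const_mul ha.ne' f x).trans (hx ▸ smul_inv_smul₀ ha.ne' K)⟩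

theorem RealizesConvexBodies.rescale (hf : RealizesConvexBodies L f) {r : ℝ} (hr : r ≠ 0)
    (z : V) : RealizesConvexBodies L (rescale r z f) := by
  intro K hK hKconv hKint hKL
  obtain ⟨x, hx⟩ := hf K hK hKconv hKint hKL
  refine ⟨z + r • x, ?_⟩
  rwa [gradientCluster_rescale hr, add_sub_cancel_left, inv_smul_smul₀ hr]

theorem RealizesConvexBodies.tsum [Nontrivial V] {ι : Type*} {F : ι → V → ℝ}
    (hdisj : Pairwise fun i j => Disjoint (tsupport (F i)) (tsupport (F j)))
    (hfin : LocallyFinite fun i => tsupport (F i)) {k : ι} (hF : RealizesConvexBodies L (F k)) :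
    RealizesConvexBodies L fun x => ∑' i, F i x := by
  intro K hK hKconv hKint hKL
  obtain ⟨x, rfl⟩ := hF K hK hKconv hKint hKL
  have hx := mem_tsupport_of_interior_gradientCluster_nonempty hKint
  exact ⟨x, gradientCluster_congr (tsum_eventuallyEq_of_mem_tsupport hdisj (hfin x) hx)⟩

theorem isTameAt_tsum {ι : Type*} [Nonempty ι] {F : ι → V → ℝ}
    (hdisj : Pairwise fun i j => Disjoint (tsupport (F i)) (tsupport (F j)))
    (hfin : LocallyFinite fun i => tsupport (F i)) (hF : ∀ i x, IsTameAt (F i) x) (x : V) :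
    IsTameAt (fun y => ∑' i, F i y) x := by
  obtain ⟨k, hk⟩ := exists_tsum_eventuallyEq hdisj (hfin x)
  exact (hF k x).congr hk

end Complete

variable [FiniteDimensional ℝ V] {L : NNReal} {f : V → ℝ}

theorem IsTameBump.const_mul (hf : IsTameBump L f) {a : NNReal} (ha : 0 < a) :
    IsTameBump (a * L) fun x => a * f x where
  isTameAt x := (hf.isTameAt x).const_mul ha
  nonneg x := mul_nonneg a.coe_nonneg (hf.nonneg x)
  hasCompactSupport := hf.hasCompactSupport.mul_left
  lipschitzWith :=
    (lipschitzWith_iff_norm_gradient_le (hf.differentiable.const_mul _)).2 fun x => by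
    rw [gradient_const_mul, norm_smul, NNReal.coe_mul, Real.norm_of_nonneg a.coe_nonneg]
    exact mul_le_mul_of_nonneg_left (hf.norm_gradient_le x) a.coe_nonneg

theorem IsTameBump.rescale (hf : IsTameBump L f) {r : ℝ} (hr : 0 < r) (z : V) :
    IsTameBump L (rescale r z f) := by
  have htame (x : V) : IsTameAt (_root_.rescale r z f) x := (hf.isTameAt _).rescale hr
  refine ⟨htame, fun x => mul_nonneg hr.le (hf.nonneg _), ?_, ?_⟩
  · exact (hf.hasCompactSupport.comp_homeomorph ((Homeomorph.subRight z).trans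
      (Homeomorph.smulOfNeZero r⁻¹ (inv_ne_zero hr.ne')))).mul_left
  · refine (lipschitzWith_iff_norm_gradient_le fun x => (htame x).differentiableAt).2 fun x => ?_
    rw [gradient_rescale hr.ne']
    exact hf.norm_gradient_le _

theorem exists_seq_isTameBump_realizesConvexBodies [Nontrivial V] (hf : IsTameBump 1 f)
    (hK : RealizesConvexBodies 1 f) :
    ∃ F : ℕ → V → ℝ, (∀ n : ℕ, IsTameBump (n + 1) (F n)) ∧
      (∀ n : ℕ, RealizesConvexBodies (n + 1) (F n)) ∧
      (Pairwise fun i j => Disjoint (tsupport (F i)) (tsupport (F j))) ∧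
      LocallyFinite fun n => tsupport (F n) := by
  obtain ⟨R, hR⟩ := hf.hasCompactSupport.isCompact.isBounded.exists_norm_le
  obtain ⟨c, hdisj, hfin⟩ := exists_pairwise_disjoint_locallyFinite_closedBall V R
  let F (n : ℕ) (x : V) : ℝ := ((n + 1 : NNReal) : ℝ) * rescale 1 (c n) f x
  have hsupp (n : ℕ) : tsupport (F n) ⊆ Metric.closedBall (c n) R := fun x hx => by
    have hmem : x ∈ tsupport (rescale 1 (c n) f) :=
      tsupport_mul_subset_right (f := fun _ => ((n + 1 : NNReal) : ℝ)) hx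
    rw [mem_tsupport_rescale_iff one_ne_zero, inv_one, one_smul] at hmem
    exact mem_closedBall_iff_norm.2 (hR _ hmem)
  refine ⟨F, fun n => ?_, fun n => ?_, fun i j hij => (hdisj hij).mono (hsupp i) (hsupp j),
    hfin.subset hsupp⟩
  · exact mul_one (n + 1 : NNReal) ▸
      (hf.rescale one_pos (c n)).const_mul (a := n + 1) (by positivity)
  · exact mul_one (n + 1 : ℝ) ▸
      (hK.rescale one_ne_zero (c n)).const_mul (a := n + 1) (by positivity)

end Family

theorem RealizesConvexBodies.exists_clarkeSubdiff_eq {N : ℕ} {f : EuclideanSpace ℝ (Fin N) → ℝ}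
    {L : ℝ} (h : RealizesConvexBodies L f) (hf : ∀ x, IsTameAt f x) (hnonneg : ∀ x, 0 ≤ f x)
    {K : Set (EuclideanSpace ℝ (Fin N))} (hK : IsConvexBody K) (hKL : K ⊆ Metric.closedBall 0 L) :
    ∃ x, clarkeSubdiff f x = K ∧ limitingSubdiff f x = K := by
  obtain ⟨x, hx⟩ := h K hK.1 hK.2.1 hK.2.2 hKL
  exact ⟨x, (clarkeSubdiff_eq_gradientCluster hf x).trans hx,
    (limitingSubdiff_eq_gradientCluster hnonneg hf x).trans hx⟩

theorem mainTheorem2 (N : ℕ) (hN : 2 ≤ N) :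
    (∃ f : EuclideanSpace ℝ (Fin N) → ℝ,
      Differentiable ℝ f ∧ LipschitzWith 1 f ∧ HasCompactSupport f ∧
      (∀ x, clarkeSubdiff f x = limitingSubdiff f x) ∧
      ∀ K : Set (EuclideanSpace ℝ (Fin N)), IsConvexBody K → K ⊆ Metric.closedBall 0 1 →
        ∃ x, clarkeSubdiff f x = K ∧ limitingSubdiff f x = K) ∧
    (∃ (f : ℕ → EuclideanSpace ℝ (Fin N) → ℝ) (g : EuclideanSpace ℝ (Fin N) → ℝ),
      (∀ n, Differentiable ℝ (f n) ∧ LipschitzWith ((n : NNReal) + 1) (f n) ∧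
        HasCompactSupport (f n) ∧
        ∀ K : Set (EuclideanSpace ℝ (Fin N)), IsConvexBody K →
          K ⊆ Metric.closedBall 0 ((n : ℝ) + 1) →
          ∃ x, clarkeSubdiff (f n) x = K ∧ limitingSubdiff (f n) x = K) ∧
      (∀ m n, m ≠ n → Disjoint (tsupport (f m)) (tsupport (f n))) ∧
      (∀ x, HasSum (fun n => f n x) (g x)) ∧
      Differentiable ℝ g ∧ LocallyLipschitz g ∧
      ∀ K : Set (EuclideanSpace ℝ (Fin N)), IsConvexBody K →
        ∃ x, clarkeSubdiff g x = K ∧ limitingSubdiff g x = K) := by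
  have : NeZero N := ⟨by omega⟩
  have orth := (EuclideanSpace.basisFun (Fin N) ℝ).orthonormal
  have hne : (⟨1, hN⟩ : Fin N) ≠ ⟨0, by omega⟩ := by simp
  obtain ⟨f, hf, hfK⟩ := exists_isTameBump_realizesConvexBodies (orth.1 _) (orth.1 _) (orth.2 hne)
  obtain ⟨F, hF, hFK, hdisj, hfin⟩ := exists_seq_isTameBump_realizesConvexBodies hf hfK
  have hg := isTameAt_tsum hdisj hfin fun n => (hF n).isTameAt
  refine ⟨⟨f, hf.differentiable, hf.lipschitzWith, hf.hasCompactSupport, fun x => ?_,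
    fun K => hfK.exists_clarkeSubdiff_eq hf.isTameAt hf.nonneg⟩, F, fun x => ∑' n, F n x,
    fun n => ⟨(hF n).differentiable, (hF n).lipschitzWith, (hF n).hasCompactSupport,
      fun K => (hFK n).exists_clarkeSubdiff_eq (hF n).isTameAt (hF n).nonneg⟩,
    fun m n hmn => hdisj hmn, hasSum_tsum_of_locallyFinite_tsupport hfin,
    fun x => (hg x).differentiableAt,
    locallyLipschitz_tsum hdisj hfin fun n => (hF n).lipschitzWith.locallyLipschitz,
    fun K hK => ?_⟩
  · exact (clarkeSubdiff_eq_gradientCluster hf.isTameAt x).trans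
      (limitingSubdiff_eq_gradientCluster hf.nonneg hf.isTameAt x).symm
  · obtain ⟨L, hL⟩ := hK.1.isBounded.subset_closedBall 0
    obtain ⟨n, hn⟩ := exists_nat_ge L
    exact ((hFK n).tsum hdisj hfin).exists_clarkeSubdiff_eq hg
      (fun x => tsum_nonneg fun n => (hF n).nonneg x) hK
      (hL.trans (Metric.closedBall_subset_closedBall (by linarith)))
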